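/- **Theorem (universal coefficients spectral sequence).** Let $R$ be a commutative ring and $M$ an $R$-module. Let $\mathcal P(R)$ be the category of finitely generated projective $R$-modules. For a category $\mathcal C$ and a functor $L\colon\mathcal C^{op}\times\mathcal C\to R\text{-Mod}$, let $F_*(\mathcal C,L)$ and $F^*(\mathcal C,L)$ be the Pirashvili–Waldhausen chain complex and the Baues–Wirsching cochain complex, $$F_n(\mathcal C,L)=\bigoplus_{X_0\xleftarrow{\sigma_1}\cdots\xleftarrow{\sigma_n}X_n}L(X_0,X_n),\qquad F^n(\mathcal C,L)=\prod_{X_0\xleftarrow{\sigma_1}\cdots\xleftarrow{\sigma_n}X_n}L(X_n,X_0),$$ with the alternating-sum differentials $$d(c\cdot(\sigma_1,\dots,\sigma_n))=L(\sigma_1,X_n)(c)\cdot(\sigma_2,\dots,\sigma_n)+\sum_{i=1}^{n-1}(-1)^i c\cdot(\sigma_1,\dots,\sigma_i\sigma_{i+1},\dots,\sigma_n)+(-1)^nL(X_0,\sigma_n)(c)\cdot(\sigma_1,\dots,\sigma_{n-1}),$$ $$d(c)(\sigma_1,\dots,\sigma_{n+1})=L(X_{n+1},\sigma_1)c(\sigma_2,\dots,\sigma_{n+1})+\sum_{i=1}^{n}(-1)^i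 c(\sigma_1,\dots,\sigma_i\sigma_{i+1},\dots,\sigma_{n+1})+(-1)^{n+1}L(\sigma_{n+1},X_0)c(\sigma_1,\dots,\sigma_n).$$ Mac Lane homology of $R$, and Mac Lane cohomology of $R$ with coefficients in $M$ regarded as a symmetric $R$-bimodule, are taken in their description as homology and cohomology of the category $\mathcal P(R)$: $$HML_q(R)=H_q\bigl(F_*(\mathcal P(R),\operatorname{Hom}_R)\bigr),\qquad HML^n(R,M)=H^n\bigl(F^*(\mathcal P(R),\operatorname{Hom}_R(-,M\otimes_R-))\bigr).$$ 1. For all $P,Q$ in $\mathcal P(R)$ the maps $$\operatorname{Hom}_R(\operatorname{Hom}_R(Q,P),M)\xleftarrow{\ \alpha\ }M\otimes_R\operatorname{Hom}_R(P,Q)\xrightarrow{\ \beta\ }\operatorname{Hom}_R(P,M\otimes_RQ),$$ $\alpha(m\otimes f)(g)=\operatorname{trace}(fg)\,m$ and $\beta(m\otimes f)(x)=m\otimes f(x)$, are isomorphisms. 2. The isomorphisms $\beta\alpha^{-1}$, applied to each sequence $X_0\leftarrow\cdots\leftarrow X_n$ with $P=X_n$, $Q=X_0$, form an isomorphism of cochain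 complexes of $R$-modules $$\Phi\colon\operatorname{Hom}_R(F_*(\mathcal P(R),\operatorname{Hom}_R),M)\cong F^*(\mathcal P(R),\operatorname{Hom}_R(-,M\otimes_R-)).$$ 3. For every injective resolution $M\to E^*$, the cochain map $\operatorname{Hom}_R(F_*(\mathcal P(R),\operatorname{Hom}_R),M)\to\operatorname{Tot}\operatorname{Hom}_R(F_*(\mathcal P(R),\operatorname{Hom}_R),E^*)$ is a quasi-isomorphism, and the spectral sequence of the bicomplex $\operatorname{Hom}_R(F_q(\mathcal P(R),\operatorname{Hom}_R),E^p)$, filtered by $p$, is a first quadrant spectral sequence of $R$-modules with differentials $d_r\colon E_r^{p,q}\to E_r^{p+r,q-r+1}$, with $$E_2^{p,q}\cong\operatorname{Ext}^p_R(HML_q(R),M)\Longrightarrow HML^{p+q}(R,M).$$ It converges to $HML^{*}(R,M)$ with respect to the finite filtration which the filtration of the total complex induces through $\Phi$ and the above quasi-isomorphism. -/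

import Mathlib

open CategoryTheory Opposite
open scoped TensorProduct DirectSum

universe w v u v' u'

namespace CatHom

/-! ### Homology and cohomology of a category with coefficients in a bimodule -/

section Category

/-- A bimodule over `C` with values in `k`-modules: a functor `Cᵒᵖ × C ⥤ Mod k`
(for `k = ℤ` these are the bimodules with values in abelian groups). -/
abbrev Bimod (k : Type u) [CommRing k] (C : Type u') [Category.{v'} C] :=
  Cᵒᵖ × C ⥤ ModuleCat.{w} k

variable {k : Type u} [CommRing k] {C : Type u'} [Category.{v'} C]

/-- Sequences `X₀ ←σ₁─ X₁ ←σ₂─ ⋯ ←σₙ─ Xₙ` of `n` composable morphisms of `C`, as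
contravariant functors on the ordered set `{0 < 1 < ⋯ < n}`. -/
abbrev Str (C : Type u') [Category.{v'} C] (n : SimplexCategory) :=
  (Fin (n.len + 1))ᵒᵖ ⥤ C

namespace Str

/-- The object `X₀`. -/
abbrev first {n : SimplexCategory} (X : Str C n) : C := X.obj (op 0)

/-- The object `Xₙ`. -/
abbrev last {n : SimplexCategory} (X : Str C n) : C := X.obj (op (Fin.last _))

/-- Restriction of a sequence along a monotone map. Along the `i`-th coface `[n] → [n+1]` this
sends `(σ₁, …, σₙ₊₁)` to `(σ₂, …, σₙ₊₁)` for `i = 0`, to `(σ₁, …, σᵢσᵢ₊₁, …, σₙ₊₁)` for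
`0 < i < n + 1`, and to `(σ₁, …, σₙ)` for `i = n + 1`. -/
def pull {m n : SimplexCategory} (θ : m ⟶ n) (X : Str C n) : Str C m :=
  (θ.toOrderHom.monotone.functor).op ⋙ X

/-- The morphism `X_{θ 0} → X₀` of the sequence; it is `σ₁` if `θ` is the coface with `i = 0` and
an identity for the other cofaces. -/
def firstMap {m n : SimplexCategory} (θ : m ⟶ n) (X : Str C n) :
    (pull θ X).first ⟶ X.first :=
  X.map (homOfLE (Fin.zero_le (θ.toOrderHom 0))).op

/-- The morphism `Xₙ → X_{θ m}` of the sequence; it is `σₙ` if `θ` is the last coface and an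
identity for the other cofaces. -/
def lastMap {m n : SimplexCategory} (θ : m ⟶ n) (X : Str C n) :
    X.last ⟶ (pull θ X).last :=
  X.map (homOfLE (Fin.le_last (θ.toOrderHom (Fin.last _)))).op

lemma firstMap_id {n : SimplexCategory} (X : Str C n) : firstMap (𝟙 n) X = 𝟙 X.first :=
  X.map_id _

lemma lastMap_id {n : SimplexCategory} (X : Str C n) : lastMap (𝟙 n) X = 𝟙 X.last :=
  X.map_id _

lemma firstMap_comp {l m n : SimplexCategory} (η : l ⟶ m) (θ : m ⟶ n) (X : Str C n) :
    firstMap (η ≫ θ) X = firstMap η (pull θ X) ≫ firstMap θ X :=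
  X.map_comp _ _

lemma lastMap_comp {l m n : SimplexCategory} (η : l ⟶ m) (θ : m ⟶ n) (X : Str C n) :
    lastMap (η ≫ θ) X = lastMap θ X ≫ lastMap η (pull θ X) :=
  X.map_comp _ _

end Str

/-- The value `L(X₀, Xₙ)`. -/
abbrev pwCoeff (L : Bimod.{w} k C) {n : SimplexCategory} (X : Str C n) : ModuleCat.{w} k :=
  L.obj (op X.first, X.last)

/-- The value `L(Xₙ, X₀)`. -/
abbrev bwCoeff (L : Bimod.{w} k C) {n : SimplexCategory} (X : Str C n) : ModuleCat.{w} k :=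
  L.obj (op X.last, X.first)

/-- The map `L(X₀, Xₙ) → L(X_{θ 0}, X_{θ m})` induced by the morphisms of the sequence. -/
def pwMap (L : Bimod.{w} k C) {m n : SimplexCategory} (θ : m ⟶ n) (X : Str C n) :
    pwCoeff L X ⟶ pwCoeff L (X.pull θ) :=
  L.map ((X.firstMap θ).op, X.lastMap θ)

/-- The map `L(X_{θ m}, X_{θ 0}) → L(Xₙ, X₀)` induced by the morphisms of the sequence. -/
def bwMap (L : Bimod.{w} k C) {m n : SimplexCategory} (θ : m ⟶ n) (X : Str C n) :
    bwCoeff L (X.pull θ) ⟶ bwCoeff L X :=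
  L.map ((X.lastMap θ).op, X.firstMap θ)

lemma pwMap_id (L : Bimod.{w} k C) {n : SimplexCategory} (X : Str C n) :
    pwMap L (𝟙 n) X = 𝟙 (pwCoeff L X) := by
  unfold pwMap
  rw [Str.firstMap_id, Str.lastMap_id]
  exact L.map_id _

lemma bwMap_id (L : Bimod.{w} k C) {n : SimplexCategory} (X : Str C n) :
    bwMap L (𝟙 n) X = 𝟙 (bwCoeff L X) := by
  unfold bwMap
  rw [Str.firstMap_id, Str.lastMap_id]
  exact L.map_id _

lemma pwMap_comp (L : Bimod.{w} k C) {l m n : SimplexCategory} (η : l ⟶ m) (θ : m ⟶ n)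
    (X : Str C n) : pwMap L (η ≫ θ) X = pwMap L θ X ≫ pwMap L η (X.pull θ) := by
  unfold pwMap
  rw [Str.firstMap_comp, Str.lastMap_comp]
  exact L.map_comp (X := (op X.first, X.last))
    (Y := (op (X.pull θ).first, (X.pull θ).last))
    (Z := (op ((X.pull θ).pull η).first, ((X.pull θ).pull η).last))
    ((X.firstMap θ).op, X.lastMap θ) (((X.pull θ).firstMap η).op, (X.pull θ).lastMap η)

lemma bwMap_comp (L : Bimod.{w} k C) {l m n : SimplexCategory} (η : l ⟶ m) (θ : m ⟶ n)
    (X : Str C n) : bwMap L (η ≫ θ) X = bwMap L η (X.pull θ) ≫ bwMap L θ X := by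
  unfold bwMap
  rw [Str.firstMap_comp, Str.lastMap_comp]
  exact L.map_comp (X := (op ((X.pull θ).pull η).last, ((X.pull θ).pull η).first))
    (Y := (op (X.pull θ).last, (X.pull θ).first)) (Z := (op X.last, X.first))
    (((X.pull θ).lastMap η).op, (X.pull θ).firstMap η) ((X.lastMap θ).op, X.firstMap θ)

open Classical in
/-- The simplicial module `n ↦ ⨁_{X₀ ← ⋯ ← Xₙ} L(X₀, Xₙ)`; an operator `θ` sends `c · X` to
the image of `c` in `L(X_{θ 0}, X_{θ m})`, placed in the summand of the restricted sequence. -/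
noncomputable def pwSimplicial (L : Bimod.{w} k C) :
    SimplicialObject (ModuleCat.{max w v' u'} k) where
  obj n := ModuleCat.of k (⨁ X : Str C n.unop, pwCoeff L X)
  map θ := ModuleCat.ofHom (DirectSum.toModule k _ _ fun X =>
    DirectSum.lof k _ (fun Y : Str C _ => pwCoeff L Y) (X.pull θ.unop) ∘ₗ
      (pwMap L θ.unop X).hom)
  map_id n := by
    ext X c
    simp only [ModuleCat.hom_ofHom, LinearMap.comp_apply, DirectSum.toModule_lof, unop_id]
    rw [pwMap_id]
    rfl
  map_comp θ η := by
    ext X c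
    simp only [ModuleCat.hom_ofHom, ModuleCat.hom_comp, LinearMap.comp_apply,
      DirectSum.toModule_lof, unop_comp]
    rw [pwMap_comp]
    rfl

/-- The cosimplicial module `n ↦ ∏_{X₀ ← ⋯ ← Xₙ} L(Xₙ, X₀)`. -/
noncomputable def bwCosimplicial (L : Bimod.{w} k C) :
    CosimplicialObject (ModuleCat.{max w v' u'} k) where
  obj n := ModuleCat.of k (∀ X : Str C n, bwCoeff L X)
  map θ := ModuleCat.ofHom (LinearMap.pi fun X =>
    (bwMap L θ X).hom ∘ₗ LinearMap.proj (X.pull θ))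
  map_id n := by
    ext c X
    change (bwMap L (𝟙 n) X).hom (c X) = c X
    rw [bwMap_id]
    rfl
  map_comp η θ := by
    ext c X
    change (bwMap L (η ≫ θ) X).hom _ = _
    rw [bwMap_comp]
    rfl

/-- The Pirashvili–Waldhausen complex `F_*(C, L)`, with differential `∑ (-1)ⁱ dᵢ`. -/
noncomputable def pwComplex (L : Bimod.{w} k C) : ChainComplex (ModuleCat.{max w v' u'} k) ℕ :=
  AlgebraicTopology.AlternatingFaceMapComplex.obj (pwSimplicial L)

/-- The Baues–Wirsching complex `F^*(C, L)`, with differential `∑ (-1)ⁱ dⁱ`. -/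
noncomputable def bwComplex (L : Bimod.{w} k C) :
    CochainComplex (ModuleCat.{max w v' u'} k) ℕ :=
  AlgebraicTopology.AlternatingCofaceMapComplex.obj (bwCosimplicial L)

open Classical in
/-- The chain `c · (σ₁, …, σₙ)`, as a linear function of `c ∈ L(X₀, Xₙ)`. -/
noncomputable def pwChain (L : Bimod.{w} k C) (n : ℕ) (X : Str C (SimplexCategory.mk n)) :
    pwCoeff L X →ₗ[k] (pwComplex L).X n :=
  DirectSum.lof k _ (fun Y : Str C (SimplexCategory.mk n) => pwCoeff L Y) X

/-- The coordinate `c(σ₁, …, σₙ) ∈ L(Xₙ, X₀)` of a cochain `c`. -/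
noncomputable def bwCoord (L : Bimod.{w} k C) (n : ℕ) (X : Str C (SimplexCategory.mk n)) :
    (bwComplex L).X n →ₗ[k] bwCoeff L X :=
  LinearMap.proj (R := k) (φ := fun Y : Str C (SimplexCategory.mk n) => bwCoeff L Y) X

/-- The formula for the differential of the Pirashvili–Waldhausen complex. -/
lemma pwComplex_d_pwChain (L : Bimod.{w} k C) (n : ℕ) (X : Str C (SimplexCategory.mk (n + 1)))
    (c : pwCoeff L X) :
    (pwComplex L).d (n + 1) n (pwChain L (n + 1) X c) =
      ∑ i : Fin (n + 2), (-1 : ℤ) ^ (i : ℕ) •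
        pwChain L n (X.pull (SimplexCategory.δ i)) (pwMap L (SimplexCategory.δ i) X c) := by
  classical
  have h : (pwComplex L).d (n + 1) n =
      AlgebraicTopology.AlternatingFaceMapComplex.objD (pwSimplicial L) n :=
    AlgebraicTopology.AlternatingFaceMapComplex.obj_d_eq _ _
  have h' : ∀ x, (AlgebraicTopology.AlternatingFaceMapComplex.objD (pwSimplicial L) n).hom x =
      ∑ i : Fin (n + 2), (-1 : ℤ) ^ (i : ℕ) • ((pwSimplicial L).δ i).hom x := fun x => by
    unfold AlgebraicTopology.AlternatingFaceMapComplex.objD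
    rw [ModuleCat.hom_sum, LinearMap.sum_apply]
    exact Finset.sum_congr rfl fun i _ => by rw [ModuleCat.hom_zsmul, LinearMap.smul_apply]
  rw [h]
  refine (h' _).trans (Finset.sum_congr rfl fun i _ => congrArg _ ?_)
  exact DirectSum.toModule_lof (R := k) (M := fun Y : Str C _ => pwCoeff L Y)
    (N := ⨁ Y : Str C (SimplexCategory.mk n), pwCoeff L Y)
    (φ := fun Y => DirectSum.lof k _ (fun Z : Str C (SimplexCategory.mk n) => pwCoeff L Z)
      (Y.pull (SimplexCategory.δ i)) ∘ₗ (pwMap L (SimplexCategory.δ i) Y).hom) X c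

/-- The formula for the differential of the Baues–Wirsching complex. -/
lemma bwCoord_bwComplex_d (L : Bimod.{w} k C) (n : ℕ) (c : (bwComplex L).X n)
    (X : Str C (SimplexCategory.mk (n + 1))) :
    bwCoord L (n + 1) X ((bwComplex L).d n (n + 1) c) =
      ∑ i : Fin (n + 2), (-1 : ℤ) ^ (i : ℕ) •
        bwMap L (SimplexCategory.δ i) X (bwCoord L n (X.pull (SimplexCategory.δ i)) c) := by
  have h : (bwComplex L).d n (n + 1) =
      AlgebraicTopology.AlternatingCofaceMapComplex.objD (bwCosimplicial L) n :=
    CochainComplex.of_d (fun n => (bwCosimplicial L).obj (SimplexCategory.mk n))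
      (AlgebraicTopology.AlternatingCofaceMapComplex.objD (bwCosimplicial L)) n
  have h' : ∀ x, (AlgebraicTopology.AlternatingCofaceMapComplex.objD (bwCosimplicial L) n).hom x =
      ∑ i : Fin (n + 2), (-1 : ℤ) ^ (i : ℕ) • ((bwCosimplicial L).δ i).hom x := fun x => by
    unfold AlgebraicTopology.AlternatingCofaceMapComplex.objD
    rw [ModuleCat.hom_sum, LinearMap.sum_apply]
    exact Finset.sum_congr rfl fun i _ => by rw [ModuleCat.hom_zsmul, LinearMap.smul_apply]
  rw [h]
  refine (congrArg (bwCoord L (n + 1) X) (h' c)).trans ?_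
  refine (map_sum (bwCoord L (n + 1) X) _ _).trans (Finset.sum_congr rfl fun i _ => ?_)
  exact map_zsmul (bwCoord L (n + 1) X) _ _

end Category

/-! ### The category `P(R)`, Mac Lane homology and cohomology -/

section Projective

variable (R : Type u) [CommRing R]

/-- The category `P(R)` of finitely generated projective `R`-modules. -/
abbrev FGProj :=
  ObjectProperty.FullSubcategory fun P : ModuleCat.{u} R =>
    Module.Finite R P ∧ Module.Projective R P

variable {R} in
/-- The linear map underlying a morphism of `P(R)`. -/
abbrev FGProj.lin {P Q : FGProj R} (f : P ⟶ Q) : P.obj →ₗ[R] Q.obj := f.hom.hom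

instance (P : FGProj R) : Module.Finite R P.obj := P.property.1

instance (P : FGProj R) : Module.Projective R P.obj := P.property.2

/-- The bimodule `Hom_R : (P, Q) ↦ Hom_R(P, Q)` on `P(R)`, lifted to a larger universe. -/
def homBimod : Bimod.{max u v} R (FGProj R) where
  obj X := ModuleCat.of R (ULift.{v} (X.1.unop.obj →ₗ[R] X.2.obj))
  map f := ModuleCat.ofHom
    { toFun := fun g => ULift.up (FGProj.lin f.2 ∘ₗ g.down ∘ₗ FGProj.lin f.1.unop)
      map_add' := fun g h => by ext; simp
      map_smul' := fun r g => by ext; simp }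
  map_id X := rfl
  map_comp f g := rfl

variable (M : Type v) [AddCommGroup M] [Module R M]

/-- The bimodule `Hom_R(-, M ⊗ -) : (P, Q) ↦ Hom_R(P, M ⊗ Q)` on `P(R)`. -/
def homTensorBimod : Bimod.{max u v} R (FGProj R) where
  obj X := ModuleCat.of R (X.1.unop.obj →ₗ[R] M ⊗[R] X.2.obj)
  map f := ModuleCat.ofHom
    { toFun := fun g => (FGProj.lin f.2).lTensor M ∘ₗ g ∘ₗ FGProj.lin f.1.unop
      map_add' := fun g h => by ext; simp
      map_smul' := fun r g => by ext; simp }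
  map_id X := by
    ext g x
    exact LinearMap.congr_fun (LinearMap.lTensor_id M X.2.obj) (g x)
  map_comp {X Y Z} f g := by
    ext h x
    exact LinearMap.congr_fun (LinearMap.lTensor_comp M (FGProj.lin g.2) (FGProj.lin f.2))
      (h (FGProj.lin f.1.unop (FGProj.lin g.1.unop x)))

/-- The Pirashvili–Waldhausen complex `F_*(P(R), Hom_R)`. -/
noncomputable abbrev pwProj : ChainComplex (ModuleCat.{max v (u + 1)} R) ℕ :=
  pwComplex.{max u v} (homBimod.{v} R)

/-- The Baues–Wirsching complex `F^*(P(R), Hom_R(-, M ⊗ -))`. -/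
noncomputable abbrev bwProj : CochainComplex (ModuleCat.{max v (u + 1)} R) ℕ :=
  bwComplex.{max u v} (homTensorBimod R M)

/-- Mac Lane homology of `R`, as the homology of the category `P(R)`:
`HML_q(R) = H_q(P(R), Hom_R)`. -/
noncomputable abbrev HMLHomology (q : ℕ) : ModuleCat.{max v (u + 1)} R :=
  (pwProj.{v} R).homology q

/-- Mac Lane cohomology of `R` with coefficients in the symmetric bimodule `M`, as the cohomology
of the category `P(R)`: `HMLⁿ(R, M) = Hⁿ(P(R), Hom_R(-, M ⊗ -))`. -/
noncomputable abbrev HMLCohomology (n : ℕ) : ModuleCat.{max v (u + 1)} R :=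
  (bwProj R M).homology n

/-- The module `M`, lifted to the universe of the complexes above. -/
abbrev liftMod : ModuleCat.{max v (u + 1)} R := ModuleCat.of R (ULift.{u + 1} M)

/-! ### Trace duality -/

/-- The trace of an endomorphism of a finitely generated projective module `P`: the map
`End_R(P) ≅ P^* ⊗ P → R` given by evaluation. -/
noncomputable def projTrace (P : Type w) [AddCommGroup P] [Module R P] [Module.Finite R P]
    [Module.Projective R P] : (P →ₗ[R] P) →ₗ[R] R :=
  contractLeft R P ∘ₗ (dualTensorHomEquiv R P P).symm.toLinearMap

/-- `α : M ⊗ Hom_R(P, Q) → Hom_R(Hom_R(Q, P), M)`, `α(m ⊗ f)(g) = trace(f g) • m`. -/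
noncomputable def traceDual (P Q : FGProj R) :
    M ⊗[R] (P.obj →ₗ[R] Q.obj) →ₗ[R] ((Q.obj →ₗ[R] P.obj) →ₗ[R] M) :=
  TensorProduct.lift (LinearMap.mk₂ R
    (fun m f => (projTrace R Q.obj ∘ₗ LinearMap.llcomp R Q.obj P.obj Q.obj f).smulRight m)
    (fun m m' f => by ext g; simp)
    (fun c m f => by ext g; simp [smul_comm c])
    (fun m f f' => by ext g; simp [add_smul])
    (fun c m f => by ext g; simp [mul_smul]))

/-- `β : M ⊗ Hom_R(P, Q) → Hom_R(P, M ⊗ Q)`, `β(m ⊗ f)(x) = m ⊗ f(x)`. -/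
noncomputable def tensorHom (P Q : FGProj R) :
    M ⊗[R] (P.obj →ₗ[R] Q.obj) →ₗ[R] (P.obj →ₗ[R] M ⊗[R] Q.obj) :=
  TensorProduct.lift (LinearMap.mk₂ R (fun m f => TensorProduct.mk R M Q.obj m ∘ₗ f)
    (fun m m' f => by ext x; simp)
    (fun c m f => by ext x; simp [TensorProduct.smul_tmul'])
    (fun m f f' => by ext x; simp [TensorProduct.tmul_add])
    (fun c m f => by ext x; simp))

lemma traceDual_tmul (P Q : FGProj R) (m : M) (f : P.obj →ₗ[R] Q.obj)
    (g : Q.obj →ₗ[R] P.obj) :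
    traceDual R M P Q (m ⊗ₜ f) g = projTrace R Q.obj (f ∘ₗ g) • m := rfl

lemma tensorHom_tmul (P Q : FGProj R) (m : M) (f : P.obj →ₗ[R] Q.obj) (x : P.obj) :
    tensorHom R M P Q (m ⊗ₜ f) x = m ⊗ₜ f x := rfl

end Projective

/-! ### Hom complexes and bicomplexes -/

section HomComplex

variable {R : Type u} [CommRing R]

/-- The cochain complex `Hom_R(F_*, N)`, with differential `φ ↦ φ ∘ d`. -/
def homComplex (F : ChainComplex (ModuleCat.{w} R) ℕ) (N : ModuleCat.{w} R) :
    CochainComplex (ModuleCat.{w} R) ℕ where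
  X n := ModuleCat.of R (F.X n ⟶ N)
  d i j := ModuleCat.ofHom (Linear.leftComp R N (F.d j i))
  shape i j h := by
    ext φ : 2
    change F.d j i ≫ φ = 0
    rw [F.shape j i h, Limits.zero_comp]
  d_comp_d' i j l _ _ := by
    ext φ : 2
    change F.d l j ≫ F.d j i ≫ φ = 0
    rw [F.d_comp_d_assoc, Limits.zero_comp]

/-- `Hom_R(F_*, N)` as a functor of `N`. -/
def homComplexFunctor (F : ChainComplex (ModuleCat.{w} R) ℕ) :
    ModuleCat.{w} R ⥤ CochainComplex (ModuleCat.{w} R) ℕ where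
  obj N := homComplex F N
  map f :=
    { f := fun n => ModuleCat.ofHom (Linear.rightComp R (F.X n) f)
      comm' := fun i j _ => by
        ext φ : 2
        exact (Category.assoc (F.d j i) (show F.X i ⟶ _ from φ) f).symm }
  map_id N := by
    ext n φ : 3
    exact Category.comp_id (show F.X n ⟶ N from φ)
  map_comp f g := by
    ext n φ : 3
    exact (Category.assoc (show F.X n ⟶ _ from φ) f g).symm

instance (F : ChainComplex (ModuleCat.{w} R) ℕ) : (homComplexFunctor F).Additive where
  map_add {N N' f g} := by
    ext n φ : 3
    exact Preadditive.comp_add _ _ _ (show F.X n ⟶ _ from φ) f g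

/-- The signs of the total complex of a cohomological bicomplex indexed by `ℕ × ℕ`. -/
instance : ComplexShape.TensorSigns (ComplexShape.up ℕ) where
  ε' := MonoidHom.mk' (fun i => (-1 : ℤˣ) ^ Multiplicative.toAdd i)
    (fun i j => pow_add (-1 : ℤˣ) _ _)
  rel_add p q r (h : p + 1 = q) := show p + r + 1 = q + r by omega
  add_rel p q r (h : p + 1 = q) := show r + p + 1 = r + q by omega
  ε'_succ p q (h : p + 1 = q) := by
    subst h
    exact (pow_succ (-1 : ℤˣ) p).trans (by rw [mul_neg, mul_one]; rfl)

/-- The bicomplex `Hom_R(F_*, E^*)`, whose object in bidegree `(p, q)` is `Hom_R(F_q, E^p)`. -/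
def homBicomplex (F : ChainComplex (ModuleCat.{w} R) ℕ) (E : CochainComplex (ModuleCat.{w} R) ℕ) :
    HomologicalComplex₂ (ModuleCat.{w} R) (ComplexShape.up ℕ) (ComplexShape.up ℕ) :=
  ((homComplexFunctor F).mapHomologicalComplex (ComplexShape.up ℕ)).obj E

/-- The total complex, with `Totⁿ = ⨁_{p + q = n} K^{p,q}` and differential `d₁ + (-1)^p d₂`. -/
noncomputable abbrev tot
    (K : HomologicalComplex₂ (ModuleCat.{w} R) (ComplexShape.up ℕ) (ComplexShape.up ℕ)) :
    CochainComplex (ModuleCat.{w} R) ℕ :=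
  K.total (ComplexShape.up ℕ)

/-- The filtration of the total complex by the first degree: `Fil^s Totⁿ` is the sum of the
`K^{p,q}` with `p + q = n` and `p ≥ s`. -/
noncomputable def totFil
    (K : HomologicalComplex₂ (ModuleCat.{w} R) (ComplexShape.up ℕ) (ComplexShape.up ℕ))
    (s : ℤ) (n : ℕ) : Submodule R ((tot K).X n) :=
  ⨆ (p : ℕ) (q : ℕ) (h : p + q = n) (_ : s ≤ p),
    LinearMap.range (K.ιTotal (ComplexShape.up ℕ) p q n h).hom

/-- A cochain map `ψ : L → K^{0,*}` with `d₁ ψ = 0` induces a cochain map `L → Tot K`. -/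
noncomputable def colAugment
    (K : HomologicalComplex₂ (ModuleCat.{w} R) (ComplexShape.up ℕ) (ComplexShape.up ℕ))
    (L : CochainComplex (ModuleCat.{w} R) ℕ) (ψ : L ⟶ K.X 0) (hψ : ψ ≫ K.d 0 1 = 0) :
    L ⟶ tot K where
  f n := ψ.f n ≫ K.ιTotal (ComplexShape.up ℕ) 0 n n (zero_add n)
  comm' i j h := by
    obtain rfl : i + 1 = j := h
    have h₁ : ψ.f i ≫ (K.d 0 1).f i = 0 :=
      congrArg (fun f => HomologicalComplex.Hom.f f i) hψ
    rw [Category.assoc, HomologicalComplex₂.total_d, Preadditive.comp_add,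
      HomologicalComplex₂.ι_D₁, HomologicalComplex₂.ι_D₂,
      HomologicalComplex₂.d₁_eq K (ComplexShape.up ℕ) (i₁ := 0) (i₁' := 1) rfl i
        (i + 1) (add_comm 1 i),
      HomologicalComplex₂.d₂_eq K (ComplexShape.up ℕ) 0 (i₂ := i) (i₂' := i + 1)
        rfl (i + 1) (zero_add _), Preadditive.comp_add, Linear.comp_units_smul,
      Linear.comp_units_smul, reassoc_of% h₁, Limits.zero_comp, smul_zero, zero_add,
      ψ.comm_assoc]
    have h₂ : ComplexShape.ε₂ (ComplexShape.up ℕ) (ComplexShape.up ℕ) (ComplexShape.up ℕ)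
        (0, i) = 1 := ComplexShape.ε_zero (ComplexShape.up ℕ)
    rw [h₂, one_smul]

/-- An augmentation `η : N → E⁰` with `d η = 0` induces the cochain map
`Hom_R(F_*, N) → Tot Hom_R(F_*, E^*)` which sends `φ : F_n → N` to the element `η ∘ φ` of the
summand `Hom_R(F_n, E⁰)`. -/
noncomputable def homAugment (F : ChainComplex (ModuleCat.{w} R) ℕ) {N : ModuleCat.{w} R}
    (E : CochainComplex (ModuleCat.{w} R) ℕ) (η : N ⟶ E.X 0) (hη : η ≫ E.d 0 1 = 0) :
    homComplex F N ⟶ tot (homBicomplex F E) :=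
  colAugment (homBicomplex F E) (homComplex F N) ((homComplexFunctor F).map η)
    (((homComplexFunctor F).map_comp η (E.d 0 1)).symm.trans
      ((congrArg _ hη).trans ((homComplexFunctor F).map_zero _ _)))

/-- The cochain map `Hom_R(F_*, N) → Tot Hom_R(F_*, E^*)` given by an injective resolution
`N → E^*`. -/
noncomputable def homResolve (F : ChainComplex (ModuleCat.{w} R) ℕ) {N : ModuleCat.{w} R}
    (E : InjectiveResolution N) : homComplex F N ⟶ tot (homBicomplex F E.cocomplex) :=
  homAugment F E.cocomplex (CochainComplex.fromSingle₀Equiv E.cocomplex N E.ι).1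
    (CochainComplex.fromSingle₀Equiv E.cocomplex N E.ι).2

end HomComplex

/-! ### Spectral sequences -/

section SpectralSequence

variable {R : Type u} [CommRing R]

/-- For a filtered cochain complex, `Z_r^s` in degree `n`: the elements of `Fil^s Kⁿ` whose
differential lies in `Fil^{s+r}`. -/
def filZ (K : CochainComplex (ModuleCat.{w} R) ℕ) (Fil : ℤ → ∀ n, Submodule R (K.X n))
    (r s : ℤ) (n : ℕ) : Submodule R (K.X n) :=
  Fil s n ⊓ (Fil (s + r) (n + 1)).comap (K.d n (n + 1)).hom

/-- For a filtered cochain complex, the submodule `Z_{r-1}^{s+1} + d Z_{r-1}^{s-r+1}` in degree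
`n` (in degree `0` the second summand is zero, since `K.d 0 0 = 0`). -/
def filB (K : CochainComplex (ModuleCat.{w} R) ℕ) (Fil : ℤ → ∀ n, Submodule R (K.X n))
    (r s : ℤ) (n : ℕ) : Submodule R (K.X n) :=
  filZ K Fil (r - 1) (s + 1) n ⊔ (filZ K Fil (r - 1) (s - r + 1) (n - 1)).map (K.d (n - 1) n).hom

/-- The data exhibiting `S` as (the part from the second page on of) the spectral sequence of a
filtered cochain complex: `E_r^{p,q} = Z_r^p / (Z_{r-1}^{p+1} + d Z_{r-1}^{p-r+1})` in total
degree `p + q`, the differentials of the pages are induced by the differential of `K`, and the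
isomorphisms `H(E_r) ≅ E_{r+1}` are induced by the inclusions `Z_{r+1}^p ⊆ Z_r^p`. -/
structure IsSpectralSequenceOf (S : E₂CohomologicalSpectralSequenceNat (ModuleCat.{w} R))
    (K : CochainComplex (ModuleCat.{w} R) ℕ) (Fil : ℤ → ∀ n, Submodule R (K.X n)) where
  /-- the class in `E_r^{p,q}` of an element of `Z_r^p` -/
  cls (r : ℤ) (hr : 2 ≤ r) (p q : ℕ) : filZ K Fil r p (p + q) →ₗ[R] (S.page r hr).X (p, q)
  cls_surjective (r : ℤ) (hr : 2 ≤ r) (p q : ℕ) : Function.Surjective (cls r hr p q)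
  ker_cls (r : ℤ) (hr : 2 ≤ r) (p q : ℕ) : LinearMap.ker (cls r hr p q) =
    (filB K Fil r p (p + q)).comap (filZ K Fil r p (p + q)).subtype
  d_cls (r : ℤ) (hr : 2 ≤ r) (p q p' q' : ℕ) (hp : (p : ℤ) + r = p') (hq : (q : ℤ) + (1 - r) = q')
    (x : filZ K Fil r p (p + q)) (y : filZ K Fil r p' (p' + q'))
    (hxy : K.d (p + q) (p' + q') x = (y : K.X (p' + q'))) :
    (S.page r hr).d (p, q) (p', q') (cls r hr p q x) = cls r hr p' q' y
  iso_cls (r : ℤ) (hr : 2 ≤ r) (p q : ℕ) (x : filZ K Fil r p (p + q))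
    (y : filZ K Fil (r + 1) p (p + q)) (hxy : (x : K.X (p + q)) = y)
    (z : (S.page r hr).cycles (p, q)) (hz : (S.page r hr).iCycles (p, q) z = cls r hr p q x) :
    (S.iso r (r + 1) (p, q) rfl hr).hom ((S.page r hr).homologyπ (p, q) z) =
      cls (r + 1) (by omega) p q y

/-- Convergence `E_2^{p,q} ⇒ H^{p+q}` of a first quadrant spectral sequence: a finite decreasing
filtration `Hⁿ = Fil⁰Hⁿ ⊇ Fil¹Hⁿ ⊇ ⋯ ⊇ Fil^{n+1}Hⁿ = 0` with isomorphisms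
`Fil^p H^{p+q} / Fil^{p+1} H^{p+q} ≅ E_∞^{p,q}`. Here `E_∞^{p,q} = E_r^{p,q}` for all `r ≥ 2` with
`r > p` and `r > q + 1`, since no nonzero differential enters or leaves `E_r^{p,q}` for such `r`. -/
structure ConvergesTo (S : E₂CohomologicalSpectralSequenceNat (ModuleCat.{w} R))
    (H : ℕ → ModuleCat.{w} R) where
  /-- the filtration -/
  fil (n : ℕ) : ℕ → Submodule R (H n)
  fil_anti (n : ℕ) : Antitone (fil n)
  fil_zero (n : ℕ) : fil n 0 = ⊤
  fil_succ (n : ℕ) : fil n (n + 1) = ⊥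
  /-- the projection onto `E_∞^{p,q} = E_r^{p,q}` -/
  gr (r : ℤ) (hr : 2 ≤ r) (p q : ℕ) (hp : (p : ℤ) < r) (hq : (q : ℤ) + 1 < r) :
    fil (p + q) p →ₗ[R] (S.page r hr).X (p, q)
  gr_surjective (r : ℤ) (hr : 2 ≤ r) (p q : ℕ) (hp : (p : ℤ) < r) (hq : (q : ℤ) + 1 < r) :
    Function.Surjective (gr r hr p q hp hq)
  ker_gr (r : ℤ) (hr : 2 ≤ r) (p q : ℕ) (hp : (p : ℤ) < r) (hq : (q : ℤ) + 1 < r) :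
    LinearMap.ker (gr r hr p q hp hq) = (fil (p + q) (p + 1)).comap (fil (p + q) p).subtype
  iso_gr (r : ℤ) (hr : 2 ≤ r) (p q : ℕ) (hp : (p : ℤ) < r) (hq : (q : ℤ) + 1 < r)
    (x : fil (p + q) p) (z : (S.page r hr).cycles (p, q))
    (hz : (S.page r hr).iCycles (p, q) z = gr r hr p q hp hq x) :
    (S.iso r (r + 1) (p, q) rfl hr).hom ((S.page r hr).homologyπ (p, q) z) =
      gr (r + 1) (by omega) p q (by omega) (by omega) x

/-- The convergence `c` of the spectral sequence of a filtered complex `K` is the one given by the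
filtration of the cohomology of `K`, transported along `θₙ : Hⁿ → Hⁿ(K)`: an element of `Hⁿ` lies
in `Fil^p Hⁿ` if and only if its image in `Hⁿ(K)` is represented by a cocycle in `Fil^p Kⁿ`, and
then its image in `E_∞^{p,q}` is the class of any such cocycle. -/
structure IsInducedConvergence {S : E₂CohomologicalSpectralSequenceNat (ModuleCat.{w} R)}
    {K : CochainComplex (ModuleCat.{w} R) ℕ} {Fil : ℤ → ∀ n, Submodule R (K.X n)}
    (ρ : IsSpectralSequenceOf S K Fil) {H : ℕ → ModuleCat.{w} R} (c : ConvergesTo S H)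
    (θ : ∀ n, H n ⟶ K.homology n) : Prop where
  mem_fil (n p : ℕ) (y : H n) : y ∈ c.fil n p ↔
    ∃ z : K.cycles n, K.iCycles n z ∈ Fil p n ∧ K.homologyπ n z = θ n y
  gr_eq (r : ℤ) (hr : 2 ≤ r) (p q : ℕ) (hp : (p : ℤ) < r) (hq : (q : ℤ) + 1 < r)
    (y : c.fil (p + q) p) (z : K.cycles (p + q)) (hz : K.homologyπ (p + q) z = θ (p + q) y)
    (x : filZ K Fil r p (p + q)) (hx : (x : K.X (p + q)) = K.iCycles (p + q) z) :
    c.gr r hr p q hp hq y = ρ.cls r hr p q x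

end SpectralSequence

end CatHom

/-! For finitely generated projective `P`, the module `Hom_R(P, Q)` is `P^* ⊗ Q`, so linear
statements about maps `P → Q` can be checked on maps of rank one. Two facts follow: the trace is
cyclic (`projTrace_comp_comm`), and the pairing `trace (f g)` identifies `Hom_R(P, Q)` with the dual
of `Hom_R(Q, P)` (`bijective_tracePairing`). The second makes `α` an isomorphism. The first makes `β
α⁻¹` natural in both variables (`traceEquiv_naturality`), so that it carries each face map of `F_*`,
dualized into `M`, to the corresponding coface map of `F^*`. This is the cochain isomorphism `Φ`.

The rest concerns the bicomplex `Hom_R(F_q, E^p)` for a complex `F_*` of modules. Each `F_q(P(R),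
Hom_R)` is a direct sum of projective modules, hence projective, so `Hom_R(F_q, E^*)` is a
resolution of `Hom_R(F_q, M)`. Clearing components from the highest column downwards then shows that
`Hom_R(F_*, M)` is quasi-isomorphic to the total complex (`quasiIso_colAugment`).

The spectral sequence is built from submodules of the filtered total complex: `E_r = Z_r / B_r`,
with `H(E_r) ≅ E_{r+1}` obtained from a surjection `Z_{r+1} → H(E_r)` whose kernel is `B_{r+1}`. The
filtration is finite in each degree, so for large `r` elements of `Z_r` are cocycles and `B_r`
detects exactly the boundaries modulo the next filtration step; this is convergence.

The second page is computed without the first one. Injectivity of `E^p` makes `Hom_R(-, E^p)` exact,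
so the `(p, q)`-component of an element of `Z_2` descends to a map `H_q(F) → E^p`, which is a
cocycle. Its class gives a map `Z_2 → Ext^p(H_q(F), M)` which is surjective
(`surjective_secondPageMap`) with kernel `B_2` (`ker_secondPageMap`). -/

namespace CatHom

/-! ### Trace duality for finitely generated projective modules -/

section Trace

variable (R : Type u) [CommRing R]

lemma finite_linearMap (P : Type v) (Q : Type w) [AddCommGroup P] [AddCommGroup Q] [Module R P]
    [Module R Q] [Module.Finite R P] [Module.Projective R P] [Module.Finite R Q] :
    Module.Finite R (P →ₗ[R] Q) :=
  Module.Finite.equiv (dualTensorHomEquiv R P Q)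

lemma projective_linearMap (P : Type v) (Q : Type w) [AddCommGroup P] [AddCommGroup Q]
    [Module R P] [Module R Q] [Module.Finite R P] [Module.Projective R P]
    [Module.Projective R Q] : Module.Projective R (P →ₗ[R] Q) :=
  Module.Projective.of_equiv (dualTensorHomEquiv R P Q)

lemma projTrace_dualTensorHom (P : Type w) [AddCommGroup P] [Module R P] [Module.Finite R P]
    [Module.Projective R P] (ξ : Module.Dual R P) (x : P) :
    projTrace R P (dualTensorHom R P P (ξ ⊗ₜ x)) = ξ x := by
  have h : (dualTensorHomEquiv R P P).symm (dualTensorHom R P P (ξ ⊗ₜ x)) = ξ ⊗ₜ x :=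
    (dualTensorHomEquiv R P P).symm_apply_apply _
  simp only [projTrace, LinearMap.comp_apply, LinearEquiv.coe_coe, h, contractLeft_apply]

variable {R}

lemma comp_dualTensorHom {P : Type v} {Q : Type w} {S : Type u'} [AddCommGroup P]
    [AddCommGroup Q] [AddCommGroup S] [Module R P] [Module R Q] [Module R S] (f : Q →ₗ[R] S)
    (ξ : Module.Dual R P) (x : Q) :
    f ∘ₗ dualTensorHom R P Q (ξ ⊗ₜ x) = dualTensorHom R P S (ξ ⊗ₜ f x) := by
  ext y; simp

lemma dualTensorHom_comp {P : Type v} {Q : Type w} {S : Type u'} [AddCommGroup P]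
    [AddCommGroup Q] [AddCommGroup S] [Module R P] [Module R Q] [Module R S] (f : S →ₗ[R] P)
    (ξ : Module.Dual R P) (x : Q) :
    dualTensorHom R P Q (ξ ⊗ₜ x) ∘ₗ f = dualTensorHom R S Q ((ξ ∘ₗ f) ⊗ₜ x) := by
  ext y; simp

/-- Linear maps out of `Hom_R(P, Q)`, for `P` finitely generated projective, agree if they agree
on the maps of rank one. -/
lemma linearMap_ext_dualTensorHom {P : Type v} {Q : Type w} {S : Type u'} [AddCommGroup P]
    [AddCommGroup Q] [AddCommGroup S] [Module R P] [Module R Q] [Module R S]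
    [Module.Finite R P] [Module.Projective R P] {φ ψ : (P →ₗ[R] Q) →ₗ[R] S}
    (h : ∀ (ξ : Module.Dual R P) (x : Q),
      φ (dualTensorHom R P Q (ξ ⊗ₜ x)) = ψ (dualTensorHom R P Q (ξ ⊗ₜ x))) : φ = ψ := by
  have : φ ∘ₗ (dualTensorHomEquiv R P Q).toLinearMap =
      ψ ∘ₗ (dualTensorHomEquiv R P Q).toLinearMap := TensorProduct.ext' h
  ext f
  obtain ⟨t, rfl⟩ := (dualTensorHomEquiv R P Q).surjective f
  exact LinearMap.congr_fun this t

/-- Both sides are linear in `f`; for `f = ξ ⊗ x` both equal `ξ (g x)`. -/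
lemma projTrace_comp_comm {P : Type v} {Q : Type w} [AddCommGroup P] [AddCommGroup Q]
    [Module R P] [Module R Q] [Module.Finite R P] [Module.Projective R P] [Module.Finite R Q]
    [Module.Projective R Q] (f : P →ₗ[R] Q) (g : Q →ₗ[R] P) :
    projTrace R Q (f ∘ₗ g) = projTrace R P (g ∘ₗ f) := by
  suffices h : projTrace R Q ∘ₗ g.lcomp R Q = projTrace R P ∘ₗ LinearMap.llcomp R P Q P g from
    LinearMap.congr_fun h f
  refine linearMap_ext_dualTensorHom fun ξ x => ?_
  simp only [LinearMap.comp_apply, LinearMap.lcomp_apply', LinearMap.llcomp_apply']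
  rw [comp_dualTensorHom, dualTensorHom_comp, projTrace_dualTensorHom, projTrace_dualTensorHom,
    LinearMap.comp_apply]

/-- The trace pairing `f ↦ (g ↦ trace (f g))`. -/
noncomputable def tracePairing (P : Type v) (Q : Type w) [AddCommGroup P] [AddCommGroup Q]
    [Module R P] [Module R Q] [Module.Finite R Q] [Module.Projective R Q] :
    (P →ₗ[R] Q) →ₗ[R] Module.Dual R (Q →ₗ[R] P) :=
  LinearMap.llcomp R (Q →ₗ[R] P) (Q →ₗ[R] Q) R (projTrace R Q) ∘ₗ LinearMap.llcomp R Q P Q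

/-- The trace pairing identifies `Hom_R(P, Q)` with the dual of `Hom_R(Q, P)`. -/
lemma bijective_tracePairing (P : Type v) (Q : Type w) [AddCommGroup P] [AddCommGroup Q]
    [Module R P] [Module R Q] [Module.Finite R Q] [Module.Projective R Q] :
    Function.Bijective (tracePairing (R := R) P Q) := by
  -- The chain is `Hom(Q, P)^* ≅ (Q^* ⊗ P)^* ≅ Hom(Q^*, P^*) ≅ Hom(P, Q^**)`. It turns the trace
  -- pairing into composition with the evaluation isomorphism `Q ≅ Q^**`.
  let e : Module.Dual R (Q →ₗ[R] P) ≃ₗ[R] (P →ₗ[R] Module.Dual R (Module.Dual R Q)) :=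
    (dualTensorHomEquiv R Q P).dualMap ≪≫ₗ
      (TensorProduct.lift.equiv (.id R) (Module.Dual R Q) P R).symm ≪≫ₗ LinearMap.lflip
  have h : ⇑e ∘ tracePairing P Q = (Module.evalEquiv R Q).congrRight := by
    funext f
    ext x ξ
    change projTrace R Q (f ∘ₗ dualTensorHom R Q P (ξ ⊗ₜ x)) = ξ (f x)
    rw [comp_dualTensorHom, projTrace_dualTensorHom]
  exact (Function.Bijective.of_comp_iff' e.bijective _).1 (h ▸ LinearEquiv.bijective _)

variable (R) (M : Type v) [AddCommGroup M] [Module R M]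

/-- With `H = Hom_R(Q, P)`, the trace pairing replaces `Hom_R(P, Q)` by `H^*`, and `H^* ⊗ M ≅
Hom_R(H, M)` because `H` is again finitely generated projective. -/
lemma bijective_traceDual (P Q : FGProj R) : Function.Bijective (traceDual R M P Q) := by
  have := finite_linearMap R Q.obj P.obj
  have := projective_linearMap R Q.obj P.obj
  let e : M ⊗[R] (P.obj →ₗ[R] Q.obj) ≃ₗ[R] ((Q.obj →ₗ[R] P.obj) →ₗ[R] M) :=
    TensorProduct.comm R _ _ ≪≫ₗ
      TensorProduct.congr (LinearEquiv.ofBijective _ (bijective_tracePairing P.obj Q.obj))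
        (LinearEquiv.refl R M) ≪≫ₗ dualTensorHomEquiv R (Q.obj →ₗ[R] P.obj) M
  have h : traceDual R M P Q = e.toLinearMap := TensorProduct.ext' fun m f => rfl
  rw [h]
  exact e.bijective

lemma bijective_tensorHom (P Q : FGProj R) : Function.Bijective (tensorHom R M P Q) := by
  have h : tensorHom R M P Q = (lTensorHomEquivHomLTensor R P.obj M Q.obj).toLinearMap := by
    rw [lTensorHomEquivHomLTensor_toLinearMap]
    exact TensorProduct.ext' fun m f => rfl
  rw [h]
  exact LinearEquiv.bijective _

/-- The isomorphism `β α⁻¹ : Hom_R(Hom_R(Q, P), M) ≅ Hom_R(P, M ⊗ Q)`. -/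
noncomputable def traceEquiv (P Q : FGProj R) :
    ((Q.obj →ₗ[R] P.obj) →ₗ[R] M) ≃ₗ[R] (P.obj →ₗ[R] M ⊗[R] Q.obj) :=
  (LinearEquiv.ofBijective _ (bijective_traceDual R M P Q)).symm ≪≫ₗ
    LinearEquiv.ofBijective _ (bijective_tensorHom R M P Q)

lemma traceEquiv_traceDual (P Q : FGProj R) (t : M ⊗[R] (P.obj →ₗ[R] Q.obj)) :
    traceEquiv R M P Q (traceDual R M P Q t) = tensorHom R M P Q t :=
  congrArg _ ((LinearEquiv.ofBijective _ (bijective_traceDual R M P Q)).symm_apply_apply t)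

/-- Naturality of `β α⁻¹` in both variables. -/
lemma traceEquiv_naturality {P P' Q Q' : FGProj R} (a : P' ⟶ P) (b : Q ⟶ Q')
    (φ : (Q.obj →ₗ[R] P.obj) →ₗ[R] M) :
    traceEquiv R M P' Q' (φ ∘ₗ LinearMap.lcomp R P.obj (FGProj.lin b) ∘ₗ
        LinearMap.llcomp R Q'.obj P'.obj P.obj (FGProj.lin a)) =
      (FGProj.lin b).lTensor M ∘ₗ traceEquiv R M P Q φ ∘ₗ FGProj.lin a := by
  obtain ⟨t, rfl⟩ := (bijective_traceDual R M P Q).surjective φ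
  rw [traceEquiv_traceDual]
  let c : (P.obj →ₗ[R] Q.obj) →ₗ[R] (P'.obj →ₗ[R] Q'.obj) :=
    LinearMap.lcomp R Q'.obj (FGProj.lin a) ∘ₗ
      LinearMap.llcomp R P.obj Q.obj Q'.obj (FGProj.lin b)
  have h₁ : traceDual R M P Q t ∘ₗ LinearMap.lcomp R P.obj (FGProj.lin b) ∘ₗ
        LinearMap.llcomp R Q'.obj P'.obj P.obj (FGProj.lin a) =
      traceDual R M P' Q' (c.lTensor M t) := by
    induction t using TensorProduct.induction_on with
    | zero => simp
    | add s t hs ht => rw [map_add, map_add, map_add, LinearMap.add_comp, hs, ht]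
    | tmul m f =>
      ext g
      -- Cyclicity moves `b` from the right end to the left, trading a trace over `Q` for one over
      -- `Q'`.
      change projTrace R Q.obj ((f ∘ₗ FGProj.lin a ∘ₗ g) ∘ₗ FGProj.lin b) • m =
        projTrace R Q'.obj (FGProj.lin b ∘ₗ f ∘ₗ FGProj.lin a ∘ₗ g) • m
      rw [projTrace_comp_comm]
  have h₂ : tensorHom R M P' Q' (c.lTensor M t) =
      (FGProj.lin b).lTensor M ∘ₗ tensorHom R M P Q t ∘ₗ FGProj.lin a := by
    clear h₁
    induction t using TensorProduct.induction_on with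
    | zero => simp
    | add s t hs ht =>
      rw [map_add, map_add, map_add, LinearMap.add_comp, LinearMap.comp_add, hs, ht]
    | tmul m f => rfl
  rw [h₁, traceEquiv_traceDual, h₂]

end Trace

/-! ### The cochain isomorphism `Φ` -/

section TraceIso

variable (R : Type u) [CommRing R] (M : Type v) [AddCommGroup M] [Module R M]

/-- The restriction of `φ : F_n(P(R), Hom_R) → M` to the summand of a sequence. -/
noncomputable def homCoord (n : ℕ) (X : Str (FGProj R) (SimplexCategory.mk n)) :
    ((pwProj.{v} R).X n ⟶ liftMod R M) →ₗ[R] ((X.first.obj →ₗ[R] X.last.obj) →ₗ[R] M) where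
  toFun φ := ULift.moduleEquiv.toLinearMap ∘ₗ φ.hom ∘ₗ
    pwChain (homBimod.{v} R) n X ∘ₗ ULift.moduleEquiv.symm.toLinearMap
  map_add' _ _ := rfl
  map_smul' _ _ := rfl

lemma bijective_homCoord (n : ℕ) :
    Function.Bijective (LinearMap.pi (homCoord R M n)) := by
  classical
  constructor
  · intro φ ψ h
    ext x : 2
    suffices φ.hom = ψ.hom from LinearMap.congr_fun this x
    refine DirectSum.linearMap_ext R fun X => LinearMap.ext fun g => ?_
    exact congrArg ULift.up (LinearMap.congr_fun (congrFun h X) g.down)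
  · intro c
    let ψ : ∀ X : Str (FGProj R) (SimplexCategory.mk n),
        pwCoeff (homBimod.{v} R) X →ₗ[R] liftMod R M := fun X =>
      ULift.moduleEquiv.symm.toLinearMap ∘ₗ c X ∘ₗ ULift.moduleEquiv.toLinearMap
    refine ⟨ModuleCat.ofHom (DirectSum.toModule R _ _ ψ), ?_⟩
    funext X
    ext g
    exact congrArg ULift.down (DirectSum.toModule_lof R (φ := ψ) X (ULift.up g))

/-- In degree `n`, the isomorphism given by `β α⁻¹` in each coordinate. -/
noncomputable def traceIsoX (n : ℕ) :
    ((pwProj.{v} R).X n ⟶ liftMod R M) ≃ₗ[R] (bwProj R M).X n :=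
  LinearEquiv.ofBijective _ (bijective_homCoord R M n) ≪≫ₗ
    LinearEquiv.piCongrRight fun X => traceEquiv R M X.last X.first

lemma bwCoord_traceIsoX (n : ℕ) (φ : (pwProj.{v} R).X n ⟶ liftMod R M)
    (X : Str (FGProj R) (SimplexCategory.mk n)) :
    bwCoord (homTensorBimod R M) n X (traceIsoX R M n φ) =
      traceEquiv R M X.last X.first (homCoord R M n X φ) := rfl

lemma homCoord_d (n : ℕ) (φ : (pwProj.{v} R).X n ⟶ liftMod R M)
    (X : Str (FGProj R) (SimplexCategory.mk (n + 1))) :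
    homCoord R M (n + 1) X ((pwProj.{v} R).d (n + 1) n ≫ φ) =
      ∑ i : Fin (n + 2), (-1 : ℤ) ^ (i : ℕ) •
        (homCoord R M n (X.pull (SimplexCategory.δ i)) φ ∘ₗ
          LinearMap.lcomp R _ (FGProj.lin (X.firstMap (SimplexCategory.δ i))) ∘ₗ
          LinearMap.llcomp R _ _ _ (FGProj.lin (X.lastMap (SimplexCategory.δ i)))) := by
  ext g
  let ℓ : (pwProj.{v} R).X n →ₗ[R] M := ULift.moduleEquiv.toLinearMap ∘ₗ φ.hom
  refine (congrArg ℓ (pwComplex_d_pwChain (homBimod.{v} R) n X (ULift.up g))).trans ?_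
  rw [map_sum, LinearMap.sum_apply]
  exact Finset.sum_congr rfl fun i _ => map_zsmul ℓ _ _

/-- The two alternating sums agree term by term: the `i`-th terms correspond by naturality of `β
α⁻¹` along `firstMap` and `lastMap` of the `i`-th coface. -/
lemma traceIsoX_d (n : ℕ) (φ : (pwProj.{v} R).X n ⟶ liftMod R M) :
    traceIsoX R M (n + 1) ((pwProj.{v} R).d (n + 1) n ≫ φ) =
      (bwProj R M).d n (n + 1) (traceIsoX R M n φ) := by
  refine funext fun X => ((bwCoord_traceIsoX R M (n + 1) _ X).trans ?_).trans
    (bwCoord_bwComplex_d (homTensorBimod R M) n (traceIsoX R M n φ) X).symm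
  rw [homCoord_d, map_sum]
  refine Finset.sum_congr rfl fun i _ => ?_
  rw [map_zsmul, traceEquiv_naturality]
  rfl

/-- The isomorphism of cochain complexes `Φ` given by `β α⁻¹` in each coordinate. -/
noncomputable def traceIso :
    homComplex (pwProj.{v} R) (liftMod R M) ≅ bwProj R M :=
  HomologicalComplex.Hom.isoOfComponents (fun n => (traceIsoX R M n).toModuleIso) <| by
    rintro n _ rfl
    ext φ : 2
    exact (traceIsoX_d R M n φ).symm

/-- Describes `Φ` without mentioning `α⁻¹`: `t` is a preimage under `α` of the restriction of `φ` to
the summand of `X`. -/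
lemma bwCoord_traceIso (n : ℕ) (φ : (pwProj.{v} R).X n ⟶ liftMod R M)
    (X : Str (FGProj R) (SimplexCategory.mk n)) (t : M ⊗[R] (X.last.obj →ₗ[R] X.first.obj))
    (h : ∀ g : X.first.obj →ₗ[R] X.last.obj, traceDual R M X.last X.first t g =
      (φ (pwChain (homBimod.{v} R) n X (ULift.up g))).down) :
    bwCoord (homTensorBimod R M) n X ((traceIso R M).hom.f n φ) =
      tensorHom R M X.last X.first t := by
  have h' : homCoord R M n X φ = traceDual R M X.last X.first t :=
    LinearMap.ext fun g => (h g).symm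
  refine (bwCoord_traceIsoX R M n φ X).trans ?_
  rw [h', traceEquiv_traceDual]

/-- The modules `F_n(P(R), Hom_R)` are projective. -/
lemma projective_pwProj (n : ℕ) : Module.Projective R ((pwProj.{v} R).X n) := by
  have (X : Str (FGProj R) (SimplexCategory.mk n)) :
      Module.Projective R (pwCoeff (homBimod.{v} R) X) := by
    have := projective_linearMap R X.first.obj X.last.obj
    exact inferInstanceAs (Module.Projective R (ULift.{v} (X.first.obj →ₗ[R] X.last.obj)))
  exact inferInstanceAs (Module.Projective R
    (⨁ X : Str (FGProj R) (SimplexCategory.mk n), pwCoeff (homBimod.{v} R) X))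

end TraceIso

/-! ### Homology of complexes of modules in terms of elements -/

section ModuleHomology

variable {R : Type u} [CommRing R] {ι : Type*} {c : ComplexShape ι}
  (K : HomologicalComplex (ModuleCat.{w} R) c)

lemma injective_iCycles (i : ι) : Function.Injective (K.iCycles i) :=
  (ModuleCat.mono_iff_injective _).1 inferInstance

lemma surjective_homologyπ (i : ι) : Function.Surjective (K.homologyπ i) :=
  (ModuleCat.epi_iff_surjective _).1 inferInstance

lemma d_d_apply (i j k : ι) (x : K.X i) : K.d j k (K.d i j x) = 0 := by
  rw [← ModuleCat.comp_apply, K.d_comp_d]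
  rfl

lemma d_iCycles_apply (i j : ι) (z : K.cycles i) : K.d i j (K.iCycles i z) = 0 := by
  rw [← ModuleCat.comp_apply, K.iCycles_d]
  rfl

lemma exists_iCycles_eq (i : ι) (x : K.X i) (hx : ∀ j, K.d i j x = 0) :
    ∃ z : K.cycles i, K.iCycles i z = x := by
  have h := ShortComplex.exact_of_f_is_kernel
    (ShortComplex.mk _ _ (K.iCycles_d i (c.next i))) (K.cyclesIsKernel i _ rfl)
  exact (ShortComplex.moduleCat_exact_iff _).1 h x (hx _)

/-- The index `j` may be arbitrary: if it does not precede `i`, the differential vanishes and forces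
`z = 0`. -/
lemma homologyπ_eq_zero_iff (i : ι) (z : K.cycles i) :
    K.homologyπ i z = 0 ↔ ∃ (j : ι) (w : K.X j), K.d j i w = K.iCycles i z := by
  have h := ShortComplex.exact_of_g_is_cokernel
    (ShortComplex.mk _ _ (K.toCycles_comp_homologyπ (c.prev i) i))
    (K.homologyIsCokernel _ i rfl)
  have h' (w : K.X (c.prev i)) : K.iCycles i (K.toCycles (c.prev i) i w) = K.d (c.prev i) i w := by
    rw [← ModuleCat.comp_apply, K.toCycles_i]
  constructor
  · intro hz
    obtain ⟨w, hw⟩ := (ShortComplex.moduleCat_exact_iff _).1 h z hz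
    exact ⟨_, w, (h' w).symm.trans (congrArg _ hw)⟩
  · rintro ⟨j, w, hw⟩
    have hπ (w : K.X (c.prev i)) : K.homologyπ i (K.toCycles (c.prev i) i w) = 0 := by
      rw [← ModuleCat.comp_apply, K.toCycles_comp_homologyπ]
      rfl
    by_cases hj : c.Rel j i
    · obtain rfl := c.prev_eq' hj
      rw [← h'] at hw
      rw [← injective_iCycles K i hw, hπ]
    · rw [K.shape _ _ hj] at hw
      rw [injective_iCycles K i (a₁ := z) (a₂ := 0) (by rw [← hw, map_zero]; rfl), map_zero]

lemma homologyπ_eq_iff (i : ι) (z z' : K.cycles i) :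
    K.homologyπ i z = K.homologyπ i z' ↔
      ∃ (j : ι) (w : K.X j), K.d j i w = K.iCycles i z - K.iCycles i z' := by
  rw [← sub_eq_zero, ← map_sub, homologyπ_eq_zero_iff, map_sub]

end ModuleHomology

/-! ### The pages of a filtered complex -/

section FilteredComplex

variable {R : Type u} [CommRing R]

/-- A decreasing filtration of a cochain complex by subcomplexes with `Fil⁰ = K` and
`Fil^{n+1} Kⁿ = 0`. -/
structure IsFirstQuadrantFiltration (K : CochainComplex (ModuleCat.{w} R) ℕ)
    (Fil : ℤ → ∀ n, Submodule R (K.X n)) : Prop where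
  anti {s t : ℤ} (h : s ≤ t) (n : ℕ) : Fil t n ≤ Fil s n
  eq_top {s : ℤ} (h : s ≤ 0) (n : ℕ) : Fil s n = ⊤
  eq_bot {s : ℤ} (n : ℕ) (h : (n : ℤ) < s) : Fil s n = ⊥
  d_mem {s : ℤ} {n : ℕ} {x : K.X n} (h : x ∈ Fil s n) : K.d n (n + 1) x ∈ Fil s (n + 1)

variable {K : CochainComplex (ModuleCat.{w} R) ℕ} {Fil : ℤ → ∀ n, Submodule R (K.X n)}

lemma mem_filZ {r s : ℤ} {n : ℕ} {x : K.X n} :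
    x ∈ filZ K Fil r s n ↔ x ∈ Fil s n ∧ K.d n (n + 1) x ∈ Fil (s + r) (n + 1) := Iff.rfl

lemma mem_filB {r s : ℤ} {n : ℕ} {x : K.X n} :
    x ∈ filB K Fil r s n ↔ ∃ a ∈ filZ K Fil (r - 1) (s + 1) n,
      ∃ b ∈ filZ K Fil (r - 1) (s - r + 1) (n - 1), a + K.d (n - 1) n b = x := by
  simp only [filB, Submodule.mem_sup, Submodule.mem_map, exists_exists_and_eq_and]

lemma mem_filB_of_mem_filZ {r s : ℤ} {n : ℕ} {x : K.X n}
    (hx : x ∈ filZ K Fil (r - 1) (s + 1) n) : x ∈ filB K Fil r s n :=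
  mem_filB.2 ⟨x, hx, 0, zero_mem _, by rw [map_zero, add_zero]⟩

lemma d_mem_filB {r s : ℤ} {n : ℕ} {x : K.X n}
    (hx : x ∈ filZ K Fil (r - 1) (s - r + 1) n) : K.d n (n + 1) x ∈ filB K Fil r s (n + 1) :=
  mem_filB.2 ⟨0, zero_mem _, x, hx, zero_add _⟩

lemma d_mem_filZ {r s s' : ℤ} (n n' : ℕ) (h : s + r = s') {x : K.X n}
    (hx : x ∈ filZ K Fil r s n) : K.d n n' x ∈ filZ K Fil r s' n' := by
  by_cases hn : n + 1 = n'
  · subst hn h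
    refine mem_filZ.2 ⟨hx.2, ?_⟩
    rw [d_d_apply]
    exact zero_mem _
  · rw [K.shape n n' hn]
    exact zero_mem _

/-- The differential kills the boundary part of `B_r^s`, and the remaining part `Z_{r-1}^{s+1}` is
`Z_{r-1}^{s'-r+1}`, whose boundaries belong to `B_r^{s'}` by definition. -/
lemma d_filB_mem_filB {r s s' : ℤ} (n n' : ℕ) (h : s + r = s') {x : K.X n}
    (hx : x ∈ filB K Fil r s n) : K.d n n' x ∈ filB K Fil r s' n' := by
  by_cases hn : n + 1 = n'
  · subst hn h
    obtain ⟨a, ha, b, -, rfl⟩ := mem_filB.1 hx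
    rw [map_add, d_d_apply, add_zero]
    exact d_mem_filB (by rwa [show s + r - r + 1 = s + 1 by ring])
  · rw [K.shape n n' hn]
    exact zero_mem _

namespace IsFirstQuadrantFiltration

variable (hF : IsFirstQuadrantFiltration K Fil)
include hF

lemma filZ_succ_le (r s : ℤ) (n : ℕ) : filZ K Fil (r + 1) s n ≤ filZ K Fil r s n :=
  fun _ hx => mem_filZ.2 ⟨hx.1, hF.anti (by omega) _ hx.2⟩

/-- An element of `Z_{r+1}` lying in `B_r` lies in `B_{r+1}`. -/
lemma mem_filB_succ {r s : ℤ} {n : ℕ} {y : K.X n} (hy : y ∈ filZ K Fil (r + 1) s n)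
    (hy' : y ∈ filB K Fil r s n) : y ∈ filB K Fil (r + 1) s n := by
  obtain ⟨a, ha, b, hb, rfl⟩ := mem_filB.1 hy'
  refine mem_filB.2 ⟨a, mem_filZ.2 ⟨ha.1, ?_⟩, b, mem_filZ.2 ⟨hF.anti (by omega) _ hb.1, ?_⟩, rfl⟩
  · have := (mem_filZ.1 hy).2
    rw [map_add, d_d_apply, add_zero] at this
    rwa [show s + 1 + (r + 1 - 1) = s + (r + 1) by ring]
  · rw [show s - (r + 1) + 1 + (r + 1 - 1) = s - r + 1 + (r - 1) by ring]
    exact hb.2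

/-- The elements of `Z_{r+1}` in `B_{r+1}` are the sums of elements of `B_r` and boundaries of
elements of `Z_r^{s-r}`. -/
lemma mem_filB_succ_iff {r s : ℤ} {n : ℕ} {y : K.X n} (hy : y ∈ filZ K Fil (r + 1) s n) :
    y ∈ filB K Fil (r + 1) s n ↔
      ∃ b ∈ filZ K Fil r (s - r) (n - 1), y - K.d (n - 1) n b ∈ filB K Fil r s n := by
  constructor
  · intro h
    obtain ⟨a, ha, b, hb, rfl⟩ := mem_filB.1 h
    refine ⟨b, ?_, ?_⟩
    · rwa [show s - (r + 1) + 1 = s - r by ring, show r + 1 - 1 = r by ring] at hb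
    · rw [add_sub_cancel_right]
      refine mem_filB_of_mem_filZ ?_
      have := hF.filZ_succ_le (r - 1) (s + 1) n
      rw [show r - 1 + 1 = r + 1 - 1 by ring] at this
      exact this ha
  · rintro ⟨b, hb, h⟩
    have h₁ : K.d (n - 1) n b ∈ filB K Fil (r + 1) s n := by
      refine mem_filB.2 ⟨0, zero_mem _, b, ?_, zero_add _⟩
      rwa [show s - (r + 1) + 1 = s - r by ring, show r + 1 - 1 = r by ring]
    have h₂ : y - K.d (n - 1) n b ∈ filZ K Fil (r + 1) s n := by
      refine sub_mem hy (mem_filZ.2 ⟨?_, ?_⟩)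
      -- In degree `0` the truncated index `n - 1` is again `0`, and `K.d 0 0 = 0`.
      · rcases n with _ | n
        · rw [K.shape _ _ (by simp)]; exact zero_mem _
        · rw [show s = s - r + r by ring]; exact hb.2
      · rw [d_d_apply]; exact zero_mem _
    simpa using add_mem (hF.mem_filB_succ h₂ h) h₁

end IsFirstQuadrantFiltration

/-- The module `E_r^s` in degree `n`. -/
abbrev FilE (K : CochainComplex (ModuleCat.{w} R) ℕ) (Fil : ℤ → ∀ n, Submodule R (K.X n))
    (r s : ℤ) (n : ℕ) : Type w :=
  filZ K Fil r s n ⧸ (filB K Fil r s n).comap (filZ K Fil r s n).subtype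

/-- The class in `E_r^s` of an element of `Z_r^s`. -/
abbrev filECls (K : CochainComplex (ModuleCat.{w} R) ℕ) (Fil : ℤ → ∀ n, Submodule R (K.X n))
    (r s : ℤ) (n : ℕ) : filZ K Fil r s n →ₗ[R] FilE K Fil r s n :=
  ((filB K Fil r s n).comap (filZ K Fil r s n).subtype).mkQ

lemma filECls_eq_zero_iff {r s : ℤ} {n : ℕ} (x : filZ K Fil r s n) :
    filECls K Fil r s n x = 0 ↔ (x : K.X n) ∈ filB K Fil r s n :=
  Submodule.Quotient.mk_eq_zero _

lemma filECls_eq_iff {r s : ℤ} {n : ℕ} (x y : filZ K Fil r s n) :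
    filECls K Fil r s n x = filECls K Fil r s n y ↔ (x : K.X n) - y ∈ filB K Fil r s n := by
  rw [← sub_eq_zero, ← map_sub, filECls_eq_zero_iff]
  rfl

/-- The map `E_r^s → E_r^{s'}`, `s' = s + r`, induced by the differential. -/
noncomputable def filEd (K : CochainComplex (ModuleCat.{w} R) ℕ)
    (Fil : ℤ → ∀ n, Submodule R (K.X n)) {r s s' : ℤ} (n n' : ℕ) (h : s + r = s') :
    FilE K Fil r s n →ₗ[R] FilE K Fil r s' n' :=
  Submodule.mapQ _ _ ((K.d n n').hom.restrict fun _ hx => d_mem_filZ n n' h hx)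
    fun _ hx => d_filB_mem_filB n n' h hx

/-- The page `E_r` of the spectral sequence of a filtered cochain complex. -/
noncomputable def filPage (K : CochainComplex (ModuleCat.{w} R) ℕ)
    (Fil : ℤ → ∀ n, Submodule R (K.X n)) (r : ℤ) :
    HomologicalComplex (ModuleCat.{w} R) (ComplexShape.spectralSequenceNat ⟨r, 1 - r⟩) where
  X a := ModuleCat.of R (FilE K Fil r a.1 (a.1 + a.2))
  -- Testing the first coordinate suffices: if the second one does not match, the total degrees are
  -- not consecutive and `K.d` is zero.
  d a b := if h : (a.1 : ℤ) + r = b.1 then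
    ModuleCat.ofHom (filEd K Fil (a.1 + a.2) (b.1 + b.2) h) else 0
  shape a b hab := by
    split_ifs with h
    · refine ModuleCat.hom_ext (LinearMap.ext fun x => ?_)
      obtain ⟨x, rfl⟩ := Submodule.mkQ_surjective _ x
      refine (filECls_eq_zero_iff _).2 ?_
      change K.d _ _ (x : K.X (a.1 + a.2)) ∈ filB K Fil r b.1 (b.1 + b.2)
      rw [K.shape _ _ (show ¬ a.1 + a.2 + 1 = b.1 + b.2 from
        fun h' => hab ⟨h, show (a.2 : ℤ) + (1 - r) = b.2 by omega⟩)]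
      exact zero_mem _
    · rfl
  d_comp_d' a b e _ _ := by
    split_ifs with h h'
    · refine ModuleCat.hom_ext (LinearMap.ext fun x => ?_)
      obtain ⟨x, rfl⟩ := Submodule.mkQ_surjective _ x
      refine (filECls_eq_zero_iff _).2 ?_
      change K.d _ _ (K.d _ _ _) ∈ _
      rw [d_d_apply]
      exact zero_mem _
    all_goals simp

lemma filPage_d_cls {r : ℤ} (a b : ℕ × ℕ) (h : (a.1 : ℤ) + r = b.1)
    (x : filZ K Fil r a.1 (a.1 + a.2)) :
    (filPage K Fil r).d a b (filECls K Fil r a.1 (a.1 + a.2) x) =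
      filECls K Fil r b.1 (b.1 + b.2) ⟨K.d (a.1 + a.2) (b.1 + b.2) x, d_mem_filZ _ _ h x.2⟩ := by
  have : (filPage K Fil r).d a b = ModuleCat.ofHom (filEd K Fil (a.1 + a.2) (b.1 + b.2) h) :=
    dif_pos h
  rw [this]
  rfl

end FilteredComplex

/-! ### Passage from one page to the next -/

section FilteredSpectralSequence

variable {R : Type u} [CommRing R]
variable {K : CochainComplex (ModuleCat.{w} R) ℕ} {Fil : ℤ → ∀ n, Submodule R (K.X n)}

/-- A surjective linear map identifies its target with the quotient by its kernel. -/
noncomputable def quotEquivOfSurjective {A B : Type*} [AddCommGroup A] [Module R A]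
    [AddCommGroup B] [Module R B] (f : A →ₗ[R] B) (hf : Function.Surjective f)
    (N : Submodule R A) (hN : LinearMap.ker f = N) : (A ⧸ N) ≃ₗ[R] B :=
  Submodule.quotEquivOfEq _ _ hN.symm ≪≫ₗ f.quotKerEquivOfSurjective hf

namespace IsFirstQuadrantFiltration

variable (hF : IsFirstQuadrantFiltration K Fil)

/-- If `x` lies in `Z_{r+1}^p`, then `d x` is a cocycle in `Fil^{p+r+1}`, so it lies in the summand
`Z_{r-1}^{p+r+1}` of `B_r^{p+r}`. -/
lemma filPage_d_cls_eq_zero {r : ℤ} (a b : ℕ × ℕ) (x : filZ K Fil r a.1 (a.1 + a.2))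
    (hx : (x : K.X (a.1 + a.2)) ∈ filZ K Fil (r + 1) a.1 (a.1 + a.2)) :
    (filPage K Fil r).d a b (filECls K Fil r a.1 (a.1 + a.2) x) = 0 := by
  by_cases hab : (ComplexShape.spectralSequenceNat ⟨r, 1 - r⟩).Rel a b
  · have h₁ : (a.1 : ℤ) + r = b.1 := hab.1
    have h₂ : (a.2 : ℤ) + (1 - r) = b.2 := hab.2
    have hn : b.1 + b.2 = a.1 + a.2 + 1 := by omega
    refine (filPage_d_cls a b h₁ x).trans ((filECls_eq_zero_iff _).2 ?_)
    change K.d (a.1 + a.2) (b.1 + b.2) (x : K.X (a.1 + a.2)) ∈ filB K Fil r b.1 (b.1 + b.2)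
    rw [hn]
    refine mem_filB_of_mem_filZ (mem_filZ.2 ⟨?_, ?_⟩)
    · rw [show (b.1 : ℤ) + 1 = a.1 + (r + 1) by omega]
      exact hx.2
    · rw [d_d_apply]
      exact zero_mem _
  · rw [HomologicalComplex.shape _ _ _ hab]
    rfl

include hF

/-- A cycle of `E_r` has a representative in `Z_{r+1}`. Vanishing of its differential means `d x = b
+ d c` with `b` in `Fil^{p+r+1}` and `c` in `Z_{r-1}^{p+1}`; then `y = x - c` has differential `b`.
-/
lemma exists_sub_mem_filB {r : ℤ} (hr : 0 ≤ r) (a : ℕ × ℕ) (x : filZ K Fil r a.1 (a.1 + a.2))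
    (hx : ∀ b, (filPage K Fil r).d a b (filECls K Fil r a.1 (a.1 + a.2) x) = 0) :
    ∃ y ∈ filZ K Fil (r + 1) a.1 (a.1 + a.2), (x : K.X (a.1 + a.2)) - y ∈
      filB K Fil r a.1 (a.1 + a.2) := by
  obtain ⟨p, q⟩ := a
  obtain ⟨x, hxZ⟩ := x
  dsimp only at x hxZ hx ⊢
  by_cases hq : 0 ≤ (q : ℤ) + (1 - r)
  · obtain ⟨q', hq'⟩ := Int.eq_ofNat_of_zero_le hq
    obtain ⟨p', hp'⟩ := Int.eq_ofNat_of_zero_le (show 0 ≤ (p : ℤ) + r by omega)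
    have hn : p' + q' = p + q + 1 := by omega
    have h := (filECls_eq_zero_iff _).1 ((filPage_d_cls (p, q) (p', q') hp' ⟨x, hxZ⟩).symm.trans
      (hx (p', q')))
    change K.d (p + q) (p' + q') x ∈ filB K Fil r p' (p' + q') at h
    rw [hn] at h
    obtain ⟨b, hb, (c : K.X (p + q)), hc, hbc⟩ := mem_filB.1 h
    change c ∈ filZ K Fil _ _ (p + q) at hc
    rw [show (p' : ℤ) - r + 1 = p + 1 by omega] at hc
    refine ⟨x - c, mem_filZ.2 ⟨sub_mem hxZ.1 (hF.anti (by omega) _ hc.1), ?_⟩, ?_⟩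
    · rw [map_sub, ← hbc, show (p : ℤ) + (r + 1) = p' + 1 by omega]
      change b + K.d (p + q) (p + q + 1) c - _ ∈ _
      rw [add_sub_cancel_right]
      exact hb.1
    · rw [sub_sub_cancel]
      exact mem_filB_of_mem_filZ hc
  -- Here the target of `d_r` is outside the quadrant: `d x` lies in `Fil^{p+r}` in degree `p + q +
  -- 1 < p + r`, so it is zero and `x` itself works.
  · refine ⟨x, mem_filZ.2 ⟨hxZ.1, ?_⟩, ?_⟩
    · have h := hxZ.2
      rw [hF.eq_bot _ (by push_cast; omega)] at h
      rw [show K.d (p + q) (p + q + 1) x = 0 from h]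
      exact zero_mem _
    · rw [sub_self]
      exact zero_mem _

/-- The classes of elements of `Z_{r+1}` in `E_r` are boundaries if and only if the elements lie
in `B_{r+1}`. -/
lemma exists_filPage_d_eq_iff {r : ℤ} (hr : 1 ≤ r) (a : ℕ × ℕ) (x : filZ K Fil r a.1 (a.1 + a.2))
    (hx : (x : K.X (a.1 + a.2)) ∈ filZ K Fil (r + 1) a.1 (a.1 + a.2)) :
    (∃ (b : ℕ × ℕ) (w : (filPage K Fil r).X b),
      (filPage K Fil r).d b a w = filECls K Fil r a.1 (a.1 + a.2) x) ↔
      (x : K.X (a.1 + a.2)) ∈ filB K Fil (r + 1) a.1 (a.1 + a.2) := by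
  obtain ⟨p, q⟩ := a
  obtain ⟨x, hxZ⟩ := x
  dsimp only at x hxZ hx ⊢
  rw [hF.mem_filB_succ_iff hx]
  constructor
  · rintro ⟨⟨p', q'⟩, w, hw⟩
    by_cases hab : (ComplexShape.spectralSequenceNat ⟨r, 1 - r⟩).Rel (p', q') (p, q)
    · have h₁ : (p' : ℤ) + r = p := hab.1
      have h₂ : (q' : ℤ) + (1 - r) = q := hab.2
      have hn : p' + q' = p + q - 1 := by omega
      obtain ⟨⟨w, hwZ⟩, rfl⟩ := Submodule.mkQ_surjective _ w
      have h := (filECls_eq_iff _ _).1 (hw.symm.trans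
        (filPage_d_cls (p', q') (p, q) h₁ ⟨w, hwZ⟩))
      change x - K.d (p' + q') (p + q) w ∈ filB K Fil r p (p + q) at h
      have hwZ' : w ∈ filZ K Fil r (p - r) (p' + q') := by rwa [show (p : ℤ) - r = p' by omega]
      clear hw hwZ
      change K.X (p' + q') at w
      generalize p' + q' = m at *
      subst hn
      exact ⟨w, hwZ', h⟩
    · rw [HomologicalComplex.shape _ _ _ hab] at hw
      have h := (filECls_eq_zero_iff _).1 hw.symm
      exact ⟨0, zero_mem _, by rwa [map_zero, sub_zero]⟩
  · rintro ⟨b, hb, h⟩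
    by_cases hp : 0 ≤ (p : ℤ) - r
    · obtain ⟨p', hp'⟩ := Int.eq_ofNat_of_zero_le hp
      obtain ⟨q', hq'⟩ := Int.eq_ofNat_of_zero_le (show 0 ≤ (q : ℤ) + r - 1 by omega)
      have hn : p + q - 1 = p' + q' := by omega
      rw [hp'] at hb
      generalize p + q - 1 = m at *
      subst hn
      refine ⟨(p', q'), filECls K Fil r p' (p' + q') ⟨b, hb⟩, ?_⟩
      refine (filPage_d_cls (p', q') (p, q) (show (p' : ℤ) + r = p by omega) ⟨b, hb⟩).trans ?_
      refine ((filECls_eq_iff _ _).2 ?_).symm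
      exact h
    -- For `p < r` no differential of `E_r` comes from inside the quadrant. Correspondingly
    -- `Fil^{p-r+1}` is everything, so `d b` already lies in `B_r`, and the class of `x` is zero.
    · refine ⟨(p, q), 0, ?_⟩
      rw [map_zero]
      refine ((filECls_eq_zero_iff _).2 ?_).symm
      change x ∈ _
      have h' : K.d (p + q - 1) (p + q) b ∈ filB K Fil r p (p + q) := by
        refine mem_filB.2 ⟨0, zero_mem _, b, mem_filZ.2 ⟨?_, ?_⟩, zero_add _⟩
        · rw [hF.eq_top (by omega)]
          exact Submodule.mem_top
        · rw [show (p : ℤ) - r + 1 + (r - 1) = p - r + r by ring]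
          exact hb.2
      simpa using add_mem h h'

/-- The map from `Z_{r+1}` to `E_r`. -/
noncomputable def toPage (r : ℤ) (a : ℕ × ℕ) :
    ModuleCat.of R (filZ K Fil (r + 1) a.1 (a.1 + a.2)) ⟶ (filPage K Fil r).X a :=
  ModuleCat.ofHom (filECls K Fil r a.1 (a.1 + a.2) ∘ₗ
    Submodule.inclusion (hF.filZ_succ_le r a.1 (a.1 + a.2)))

lemma toPage_d (r : ℤ) (a b : ℕ × ℕ) : hF.toPage r a ≫ (filPage K Fil r).d a b = 0 :=
  ModuleCat.hom_ext (LinearMap.ext fun y => filPage_d_cls_eq_zero a b _ y.2)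

/-- The map from `Z_{r+1}` to the homology of `E_r`. -/
noncomputable def toPageHomology (r : ℤ) (a : ℕ × ℕ) :
    filZ K Fil (r + 1) a.1 (a.1 + a.2) →ₗ[R] (filPage K Fil r).homology a :=
  ((filPage K Fil r).liftCycles (hF.toPage r a) _ rfl (hF.toPage_d r a _) ≫
    (filPage K Fil r).homologyπ a).hom

/-- A cycle of `E_r` is determined by its image in `E_r`, so the lift used in the definition can be
replaced by any `z` with the right class. -/
lemma toPageHomology_eq (r : ℤ) (a : ℕ × ℕ) (y : filZ K Fil (r + 1) a.1 (a.1 + a.2))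
    (x : filZ K Fil r a.1 (a.1 + a.2)) (hxy : (x : K.X (a.1 + a.2)) = y)
    (z : (filPage K Fil r).cycles a)
    (hz : (filPage K Fil r).iCycles a z = filECls K Fil r a.1 (a.1 + a.2) x) :
    hF.toPageHomology r a y = (filPage K Fil r).homologyπ a z := by
  refine congrArg ((filPage K Fil r).homologyπ a) (injective_iCycles _ _ ?_)
  refine Eq.trans ?_ hz.symm
  refine (LinearMap.congr_fun (congrArg ModuleCat.Hom.hom
    ((filPage K Fil r).liftCycles_i (hF.toPage r a) _ rfl (hF.toPage_d r a _))) y).trans ?_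
  exact congrArg (filECls K Fil r a.1 (a.1 + a.2)) (Subtype.ext hxy.symm)

lemma surjective_toPageHomology {r : ℤ} (hr : 0 ≤ r) (a : ℕ × ℕ) :
    Function.Surjective (hF.toPageHomology r a) := by
  intro h
  obtain ⟨z, rfl⟩ := surjective_homologyπ _ _ h
  obtain ⟨x, hx⟩ := Submodule.mkQ_surjective _ ((filPage K Fil r).iCycles a z)
  obtain ⟨y, hy, hxy⟩ := hF.exists_sub_mem_filB hr a x fun b => by
    rw [hx]
    exact d_iCycles_apply _ _ _ z
  exact ⟨⟨y, hy⟩, hF.toPageHomology_eq r a ⟨y, hy⟩ ⟨y, hF.filZ_succ_le _ _ _ hy⟩ rfl z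
    (hx.symm.trans ((filECls_eq_iff _ _).2 hxy))⟩

lemma ker_toPageHomology {r : ℤ} (hr : 1 ≤ r) (a : ℕ × ℕ) :
    LinearMap.ker (hF.toPageHomology r a) =
      (filB K Fil (r + 1) a.1 (a.1 + a.2)).comap (filZ K Fil (r + 1) a.1 (a.1 + a.2)).subtype := by
  ext y
  let x : filZ K Fil r a.1 (a.1 + a.2) := ⟨y, hF.filZ_succ_le _ _ _ y.2⟩
  obtain ⟨z, hz⟩ := exists_iCycles_eq (filPage K Fil r) a (filECls K Fil r a.1 (a.1 + a.2) x)
    fun b => filPage_d_cls_eq_zero a b x y.2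
  rw [LinearMap.mem_ker, hF.toPageHomology_eq r a y x rfl z hz, homologyπ_eq_zero_iff, hz]
  exact hF.exists_filPage_d_eq_iff hr a x y.2

/-- The isomorphism `H(E_r) ≅ E_{r+1}`. -/
noncomputable def pageIso {r : ℤ} (hr : 1 ≤ r) (a : ℕ × ℕ) :
    (filPage K Fil r).homology a ≅ (filPage K Fil (r + 1)).X a :=
  (quotEquivOfSurjective (hF.toPageHomology r a) (hF.surjective_toPageHomology (by omega) a) _
    (hF.ker_toPageHomology hr a)).symm.toModuleIso

/-- The spectral sequence of a filtered cochain complex. -/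
noncomputable def spectralSequence : E₂CohomologicalSpectralSequenceNat (ModuleCat.{w} R) where
  page r _ := filPage K Fil r
  iso r r' a hr' hr := by
    subst hr'
    exact hF.pageIso (by omega) a

/-- The spectral sequence constructed from a filtered cochain complex satisfies its
characterization. -/
noncomputable def isSpectralSequenceOf : IsSpectralSequenceOf hF.spectralSequence K Fil where
  cls r _ p q := filECls K Fil r p (p + q)
  cls_surjective r _ p q := Submodule.mkQ_surjective _
  ker_cls r _ p q := Submodule.ker_mkQ _
  d_cls r hr p q p' q' hp hq x y hxy :=
    (filPage_d_cls (p, q) (p', q') hp x).trans (congrArg _ (Subtype.ext hxy))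
  iso_cls r hr p q x y hxy z hz := by
    have h := hF.toPageHomology_eq r (p, q) y x hxy z hz
    exact (LinearEquiv.symm_apply_eq _).2 h.symm

end IsFirstQuadrantFiltration

end FilteredSpectralSequence

/-! ### Convergence to the cohomology of the filtered complex -/

section Convergence

variable {R : Type u} [CommRing R]
variable {K : CochainComplex (ModuleCat.{w} R) ℕ} {Fil : ℤ → ∀ n, Submodule R (K.X n)}
  {S : E₂CohomologicalSpectralSequenceNat (ModuleCat.{w} R)} {H : ℕ → ModuleCat.{w} R}

/-- The filtration of the cohomology of a filtered complex, transported along `θ`. -/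
noncomputable def inducedFil (Fil : ℤ → ∀ n, Submodule R (K.X n)) (θ : ∀ n, H n ⟶ K.homology n)
    (n p : ℕ) : Submodule R (H n) :=
  (((Fil p n).comap (K.iCycles n).hom).map (K.homologyπ n).hom).comap (θ n).hom

lemma mem_inducedFil (θ : ∀ n, H n ⟶ K.homology n) {n p : ℕ} {y : H n} :
    y ∈ inducedFil Fil θ n p ↔
      ∃ z : K.cycles n, K.iCycles n z ∈ Fil p n ∧ K.homologyπ n z = θ n y := Iff.rfl

lemma iCycles_mem_filZ (r s : ℤ) {n : ℕ} {z : K.cycles n} (hz : K.iCycles n z ∈ Fil s n) :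
    K.iCycles n z ∈ filZ K Fil r s n :=
  mem_filZ.2 ⟨hz, by rw [d_iCycles_apply]; exact zero_mem _⟩

lemma IsSpectralSequenceOf.cls_eq_zero_iff (ρ : IsSpectralSequenceOf S K Fil) {r : ℤ}
    (hr : 2 ≤ r) {p q : ℕ}
    (x : filZ K Fil r p (p + q)) :
    ρ.cls r hr p q x = 0 ↔ (x : K.X (p + q)) ∈ filB K Fil r p (p + q) := by
  rw [← LinearMap.mem_ker, ρ.ker_cls]
  rfl

namespace IsFirstQuadrantFiltration

variable (hF : IsFirstQuadrantFiltration K Fil)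

include hF in
/-- If `r > q + 1`, then all elements of `Z_r^{p,q}` are cocycles. -/
lemma exists_iCycles_eq_of_mem_filZ {r : ℤ} {p q : ℕ} (hq : (q : ℤ) + 1 < r) {x : K.X (p + q)}
    (hx : x ∈ filZ K Fil r p (p + q)) : ∃ z, K.iCycles (p + q) z = x := by
  refine exists_iCycles_eq K _ x fun j => ?_
  by_cases hj : p + q + 1 = j
  · subst hj
    have h := hx.2
    rw [hF.eq_bot _ (by push_cast; omega)] at h
    exact h
  · rw [K.shape _ _ hj]
    rfl

include hF in
/-- If `r > p`, then the class in `E_r^{p,q}` of a cocycle in `Fil^p` is zero if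
and only if the cocycle is cohomologous to a cocycle in `Fil^{p+1}`. -/
lemma iCycles_mem_filB_iff {r : ℤ} {p q : ℕ} (hp : (p : ℤ) < r)
    {z : K.cycles (p + q)} (hz : K.iCycles (p + q) z ∈ Fil p (p + q)) :
    K.iCycles (p + q) z ∈ filB K Fil r p (p + q) ↔
      ∃ z', K.iCycles (p + q) z' ∈ Fil (p + 1 : ℕ) (p + q) ∧
        K.homologyπ (p + q) z' = K.homologyπ (p + q) z := by
  constructor
  · intro h
    obtain ⟨a, ha, b, hb, hab⟩ := mem_filB.1 h
    obtain ⟨z', rfl⟩ := exists_iCycles_eq K _ a fun j => by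
      rw [eq_sub_of_add_eq hab, map_sub, d_d_apply, d_iCycles_apply, sub_zero]
    refine ⟨z', by push_cast; exact ha.1, Eq.symm ?_⟩
    exact (homologyπ_eq_iff _ _ _ _).2 ⟨_, b, eq_sub_of_add_eq' hab⟩
  · rintro ⟨z', hz', h⟩
    obtain ⟨j, b, hb⟩ := (homologyπ_eq_iff _ _ _ _).1 h.symm
    have h₁ : K.iCycles (p + q) z' ∈ filB K Fil r p (p + q) :=
      mem_filB_of_mem_filZ (iCycles_mem_filZ _ _ (by push_cast at hz'; exact hz'))
    have h₂ : K.d j (p + q) b ∈ filB K Fil r p (p + q) := by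
      by_cases hj : j + 1 = p + q
      · have hd : K.d j (p + q) b ∈ Fil p (p + q) := by
          rw [hb]
          exact sub_mem hz (hF.anti (by push_cast; omega) _ hz')
        generalize p + q = m at *
        subst hj
        refine d_mem_filB (mem_filZ.2 ⟨?_, ?_⟩)
        -- Since `p < r`, the index `p - r + 1` is at most `0`: the condition on the filtration of
        -- `b` is empty, so every boundary lying in `Fil^p` counts.
        · rw [hF.eq_top (by omega)]
          exact Submodule.mem_top
        · rwa [show (p : ℤ) - r + 1 + (r - 1) = p by ring]
      · rw [K.shape _ _ hj]
        exact zero_mem _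
    rw [show K.iCycles (p + q) z = K.d j (p + q) b + K.iCycles (p + q) z' by
      rw [hb, sub_add_cancel]]
    exact add_mem h₂ h₁

variable (ρ : IsSpectralSequenceOf S K Fil)

include hF in
/-- The class in `E_r^{p,q}`, for `r > p`, of a cocycle depends only on its
cohomology class. -/
lemma cls_eq_of_homologyπ_eq {r : ℤ} (hr : 2 ≤ r) {p q : ℕ} (hp : (p : ℤ) < r)
    (x x' : filZ K Fil r p (p + q)) {z z' : K.cycles (p + q)}
    (hz : K.iCycles (p + q) z = x) (hz' : K.iCycles (p + q) z' = x')
    (h : K.homologyπ (p + q) z = K.homologyπ (p + q) z') :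
    ρ.cls r hr p q x = ρ.cls r hr p q x' := by
  rw [← sub_eq_zero, ← map_sub, ρ.cls_eq_zero_iff]
  have h' : ((x - x' : filZ K Fil r p (p + q)) : K.X (p + q)) = K.iCycles (p + q) (z - z') := by
    rw [map_sub, hz, hz']
    rfl
  have hmem := (x - x').2.1
  rw [h'] at hmem ⊢
  refine (hF.iCycles_mem_filB_iff hp hmem).2 ⟨0, ?_, ?_⟩
  · rw [map_zero]
    exact zero_mem _
  · rw [map_zero, map_sub, h, sub_self]

variable (θ : ∀ n, H n ⟶ K.homology n) (hθ : ∀ n, Function.Bijective (θ n))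

/-- A cocycle in `Fil^p` representing an element of the induced filtration. -/
noncomputable def representative {n p : ℕ} (y : inducedFil Fil θ n p) : K.cycles n :=
  ((mem_inducedFil θ).1 y.2).choose

lemma iCycles_representative_mem {n p : ℕ} (y : inducedFil Fil θ n p) :
    K.iCycles n (representative θ y) ∈ Fil p n :=
  ((mem_inducedFil θ).1 y.2).choose_spec.1

lemma homologyπ_representative {n p : ℕ} (y : inducedFil Fil θ n p) :
    K.homologyπ n (representative θ y) = θ n y :=
  ((mem_inducedFil θ).1 y.2).choose_spec.2

/-- The projection of the induced filtration onto `E_∞`. -/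
noncomputable def inducedGr (r : ℤ) (hr : 2 ≤ r) (p q : ℕ) (hp : (p : ℤ) < r) :
    inducedFil Fil θ (p + q) p →ₗ[R] (S.page r hr).X (p, q) where
  -- The representative is chosen arbitrarily; linearity holds because for `r > p` the class depends
  -- only on the cohomology class.
  toFun y := ρ.cls r hr p q ⟨_, iCycles_mem_filZ r p (iCycles_representative_mem θ y)⟩
  map_add' y y' := by
    rw [← map_add]
    refine hF.cls_eq_of_homologyπ_eq ρ hr hp _ _ rfl
      (z' := representative θ y + representative θ y') (map_add _ _ _) ?_
    rw [map_add, homologyπ_representative, homologyπ_representative, homologyπ_representative]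
    exact map_add _ _ _
  map_smul' a y := by
    rw [RingHom.id_apply, ← map_smul]
    refine hF.cls_eq_of_homologyπ_eq ρ hr hp _ _ rfl
      (z' := a • representative θ y) (map_smul (K.iCycles (p + q)).hom _ _) ?_
    rw [homologyπ_representative]
    refine Eq.trans ?_ (map_smul (K.homologyπ (p + q)).hom _ _).symm
    refine Eq.trans ?_ (congrArg (a • ·) (homologyπ_representative θ y).symm)
    exact map_smul (θ (p + q)).hom a y.1

lemma inducedGr_eq {r : ℤ} (hr : 2 ≤ r) {p q : ℕ} (hp : (p : ℤ) < r)
    (y : inducedFil Fil θ (p + q) p) (z : K.cycles (p + q))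
    (hz : K.homologyπ (p + q) z = θ (p + q) y) (x : filZ K Fil r p (p + q))
    (hx : (x : K.X (p + q)) = K.iCycles (p + q) z) :
    hF.inducedGr ρ θ r hr p q hp y = ρ.cls r hr p q x :=
  hF.cls_eq_of_homologyπ_eq ρ hr hp _ _ rfl hx.symm
    ((homologyπ_representative θ y).trans hz.symm)

/-- The spectral sequence of a filtered complex converges to its cohomology. -/
noncomputable def convergesTo : ConvergesTo S H where
  fil := inducedFil Fil θ
  fil_anti n := antitone_nat_of_succ_le fun p y hy => by
    obtain ⟨z, hz, h⟩ := (mem_inducedFil θ).1 hy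
    exact (mem_inducedFil θ).2 ⟨z, hF.anti (by push_cast; omega) _ hz, h⟩
  fil_zero n := by
    refine eq_top_iff.2 fun y _ => (mem_inducedFil θ).2 ?_
    obtain ⟨z, hz⟩ := surjective_homologyπ K n (θ n y)
    refine ⟨z, ?_, hz⟩
    rw [hF.eq_top (by simp)]
    exact Submodule.mem_top
  fil_succ n := by
    refine eq_bot_iff.2 fun y hy => ?_
    obtain ⟨z, hz, h⟩ := (mem_inducedFil θ).1 hy
    rw [hF.eq_bot n (by push_cast; omega)] at hz
    have h0 : z = 0 := injective_iCycles K n ((show K.iCycles n z = 0 from hz).trans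
      (map_zero _).symm)
    refine (hθ n).1 ?_
    rw [← h, h0, map_zero, map_zero]
  gr r hr p q hp _ := hF.inducedGr ρ θ r hr p q hp
  gr_surjective r hr p q hp hq e := by
    obtain ⟨x, rfl⟩ := ρ.cls_surjective r hr p q e
    obtain ⟨z, hz⟩ := hF.exists_iCycles_eq_of_mem_filZ hq x.2
    obtain ⟨y, hy⟩ := (hθ (p + q)).2 (K.homologyπ (p + q) z)
    refine ⟨⟨y, (mem_inducedFil θ).2 ⟨z, ?_, hy.symm⟩⟩, ?_⟩
    · rw [hz]
      exact x.2.1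
    · exact hF.inducedGr_eq ρ θ hr hp _ z hy.symm x hz.symm
  ker_gr r hr p q hp _ := by
    ext y
    rw [LinearMap.mem_ker, Submodule.mem_comap]
    refine (ρ.cls_eq_zero_iff hr _).trans
      ((hF.iCycles_mem_filB_iff hp (iCycles_representative_mem θ y)).trans ?_)
    rw [homologyπ_representative]
    rfl
  iso_gr r hr p q _ _ x z hz :=
    ρ.iso_cls r hr p q _ ⟨_, iCycles_mem_filZ (r + 1) p (iCycles_representative_mem θ x)⟩ rfl z hz

lemma isInducedConvergence : IsInducedConvergence ρ (hF.convergesTo ρ θ hθ) θ where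
  mem_fil _ _ _ := mem_inducedFil θ
  gr_eq _ hr _ _ hp _ y z hz x hx := hF.inducedGr_eq ρ θ hr hp y z hz x hx

end IsFirstQuadrantFiltration

end Convergence

/-! ### Components of the total complex and its filtration -/

section Total

variable {R : Type u} [CommRing R]
  (K : HomologicalComplex₂ (ModuleCat.{w} R) (ComplexShape.up ℕ) (ComplexShape.up ℕ))

/-- The inclusion of `K^{p,q}` in `Tot^{p+q}`. -/
noncomputable abbrev totι (p q n : ℕ) (h : p + q = n) : (K.X p).X q ⟶ (tot K).X n :=
  K.ιTotal (ComplexShape.up ℕ) p q n h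

/-- The projection of `Totⁿ` onto `K^{p,q}`, which is zero unless `p + q = n`. -/
noncomputable def totπ (p q n : ℕ) : (tot K).X n ⟶ (K.X p).X q :=
  K.totalDesc fun i j _ => if h : i = p ∧ j = q then (K.XXIsoOfEq _ _ _ h.1 h.2).hom else 0

lemma totπ_totι_self (p q n : ℕ) (h : p + q = n) (x : (K.X p).X q) :
    totπ K p q n (totι K p q n h x) = x := by
  have : totι K p q n h ≫ totπ K p q n = 𝟙 _ := by
    rw [totπ, HomologicalComplex₂.ι_totalDesc, dif_pos ⟨rfl, rfl⟩]
    rfl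
  rw [← ModuleCat.comp_apply, this]
  rfl

lemma totπ_totι_of_ne (p q n p' q' : ℕ) (h : p + q = n) (hne : ¬ (p = p' ∧ q = q'))
    (x : (K.X p).X q) : totπ K p' q' n (totι K p q n h x) = 0 := by
  have : totι K p q n h ≫ totπ K p' q' n = 0 := by
    rw [totπ, HomologicalComplex₂.ι_totalDesc, dif_neg hne]
  rw [← ModuleCat.comp_apply, this]
  rfl

lemma tot_hom_ext {n : ℕ} {A : ModuleCat.{w} R} {f g : (tot K).X n ⟶ A}
    (h : ∀ (p q : ℕ) (hpq : p + q = n) (x : (K.X p).X q),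
      f (totι K p q n hpq x) = g (totι K p q n hpq x)) : f = g :=
  HomologicalComplex₂.total.hom_ext (ComplexShape.up ℕ) fun p q hpq =>
    ModuleCat.hom_ext (LinearMap.ext fun x => h p q hpq x)

lemma sum_hom_apply {ι : Type*} (t : Finset ι) {A B : ModuleCat.{w} R} (f : ι → (A ⟶ B)) (x : A) :
    (∑ i ∈ t, f i) x = ∑ i ∈ t, f i x := by
  change (∑ i ∈ t, f i).hom x = _
  rw [ModuleCat.hom_sum, LinearMap.sum_apply]

lemma sum_totι_totπ (n : ℕ) (x : (tot K).X n) :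
    ∑ i : Fin (n + 1), totι K i (n - i) n (by omega) (totπ K i (n - i) n x) = x := by
  have : ∑ i : Fin (n + 1), totπ K i (n - i) n ≫ totι K i (n - i) n (by omega) = 𝟙 _ := by
    refine tot_hom_ext K fun p q h x => ?_
    obtain rfl : q = n - p := by omega
    rw [sum_hom_apply, Finset.sum_eq_single ⟨p, by omega⟩]
    · change totι K p (n - p) n h (totπ K p (n - p) n (totι K p (n - p) n h x)) = _
      rw [totπ_totι_self]
      rfl
    · intro i _ hi
      change totι K i (n - i) n _ (totπ K i (n - i) n (totι K p (n - p) n h x)) = _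
      rw [totπ_totι_of_ne, map_zero]
      exact fun h' => hi (Fin.ext h'.1.symm)
    · simp
  exact (sum_hom_apply _ _ x).symm.trans
    (LinearMap.congr_fun (congrArg ModuleCat.Hom.hom this) x)

lemma tot_ext {n : ℕ} {x y : (tot K).X n}
    (h : ∀ p q, p + q = n → totπ K p q n x = totπ K p q n y) : x = y := by
  rw [← sum_totι_totπ K n x, ← sum_totι_totπ K n y]
  exact Finset.sum_congr rfl fun i _ => by rw [h _ _ (by omega)]

lemma tot_d_totι (p q n : ℕ) (h : p + q = n) (x : (K.X p).X q) :
    (tot K).d n (n + 1) (totι K p q n h x) =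
      totι K (p + 1) q (n + 1) (by omega) ((K.d p (p + 1)).f q x) +
        (-1 : ℤ) ^ p • totι K p (q + 1) (n + 1) (by omega) ((K.X p).d q (q + 1) x) := by
  have h₁ : ComplexShape.ε₁ (ComplexShape.up ℕ) (ComplexShape.up ℕ) (ComplexShape.up ℕ)
      (p, q) = 1 := rfl
  have h₂ : ComplexShape.ε₂ (ComplexShape.up ℕ) (ComplexShape.up ℕ) (ComplexShape.up ℕ)
      (p, q) = (-1 : ℤˣ) ^ p := rfl
  have : totι K p q n h ≫ (tot K).d n (n + 1) =
      (K.d p (p + 1)).f q ≫ totι K (p + 1) q (n + 1) (by omega) +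
        (-1 : ℤ) ^ p • (K.X p).d q (q + 1) ≫ totι K p (q + 1) (n + 1) (by omega) := by
    rw [HomologicalComplex₂.total_d, Preadditive.comp_add,
      HomologicalComplex₂.ι_D₁, HomologicalComplex₂.ι_D₂,
      HomologicalComplex₂.d₁_eq K (ComplexShape.up ℕ) (i₁ := p) (i₁' := p + 1) rfl q
        (n + 1) (by change p + 1 + q = n + 1; omega),
      HomologicalComplex₂.d₂_eq K (ComplexShape.up ℕ) p (i₂ := q) (i₂' := q + 1)
        rfl (n + 1) (by change p + (q + 1) = n + 1; omega), h₁, h₂, one_smul]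
    congr 1
  exact LinearMap.congr_fun (congrArg ModuleCat.Hom.hom this) x

/-- Truncated subtraction is harmless on the border: for `p = 0` or `q = 0` the corresponding term
involves `d 0 0`, which is zero. -/
lemma totπ_d (p q n : ℕ) (h : p + q = n + 1) (x : (tot K).X n) :
    totπ K p q (n + 1) ((tot K).d n (n + 1) x) =
      (K.d (p - 1) p).f q (totπ K (p - 1) q n x) +
        (-1 : ℤ) ^ p • (K.X p).d (q - 1) q (totπ K p (q - 1) n x) := by
  have : (tot K).d n (n + 1) ≫ totπ K p q (n + 1) =
      totπ K (p - 1) q n ≫ (K.d (p - 1) p).f q +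
        (-1 : ℤ) ^ p • totπ K p (q - 1) n ≫ (K.X p).d (q - 1) q := by
    refine tot_hom_ext K fun p' q' h' x => ?_
    change totπ K p q (n + 1) ((tot K).d n (n + 1) (totι K p' q' n h' x)) =
      (K.d (p - 1) p).f q (totπ K (p - 1) q n (totι K p' q' n h' x)) +
        (-1 : ℤ) ^ p • (K.X p).d (q - 1) q (totπ K p (q - 1) n (totι K p' q' n h' x))
    rw [tot_d_totι, map_add, map_zsmul]
    by_cases h₁ : p = p' + 1
    · obtain rfl : q = q' := by omega
      subst h₁
      rw [totπ_totι_self, totπ_totι_of_ne K _ _ _ _ _ _ (by omega),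
        totπ_totι_of_ne K _ _ _ (p' + 1) (q - 1) _ (by omega), smul_zero, map_zero, smul_zero]
      refine congrArg (· + _) (congrArg _ ?_)
      exact (totπ_totι_self K p' q n h' x).symm
    · by_cases h₂ : p = p'
      · obtain rfl : q = q' + 1 := by omega
        subst h₂
        rw [totπ_totι_self, totπ_totι_of_ne K _ _ _ _ _ _ (by omega),
          totπ_totι_of_ne K _ _ _ (p - 1) (q' + 1) _ (by omega), map_zero]
        refine congrArg₂ (· + ·) rfl (congrArg ((-1 : ℤ) ^ p • (K.X p).d q' (q' + 1) ·) ?_)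
        exact (totπ_totι_self K p q' n h' x).symm
      · rw [totπ_totι_of_ne K _ _ _ _ _ _ (by omega), totπ_totι_of_ne K _ _ _ _ _ _ (by omega),
          totπ_totι_of_ne K _ _ _ _ _ _ (by omega), totπ_totι_of_ne K _ _ _ _ _ _ (by omega)]
        simp
  exact LinearMap.congr_fun (congrArg ModuleCat.Hom.hom this) x

/-- Since `Totⁿ` is the direct sum of its components, the filtration can be tested by the vanishing
of those in columns below `s`, which is how it is used from here on. -/
lemma mem_totFil_iff {s : ℤ} {n : ℕ} {x : (tot K).X n} :
    x ∈ totFil K s n ↔ ∀ p q : ℕ, p + q = n → (p : ℤ) < s → totπ K p q n x = 0 := by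
  constructor
  · intro hx p q h hp
    suffices totFil K s n ≤ LinearMap.ker (totπ K p q n).hom from this hx
    refine iSup_le fun p' => iSup_le fun q' => iSup_le fun h' => iSup_le fun hs => ?_
    rintro _ ⟨y, rfl⟩
    exact totπ_totι_of_ne K p' q' n p q h' (by omega) y
  · intro h
    rw [← sum_totι_totπ K n x]
    refine Submodule.sum_mem _ fun i _ => ?_
    by_cases hi : s ≤ (i : ℕ)
    · exact Submodule.mem_iSup_of_mem (i : ℕ) (Submodule.mem_iSup_of_mem (n - i)
        (Submodule.mem_iSup_of_mem (by omega) (Submodule.mem_iSup_of_mem hi ⟨_, rfl⟩)))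
    · rw [h _ _ (by omega) (by omega), map_zero]
      exact zero_mem _

lemma totι_mem_totFil {s : ℤ} (p q n : ℕ) (h : p + q = n) (hs : s ≤ p) (x : (K.X p).X q) :
    totι K p q n h x ∈ totFil K s n :=
  (mem_totFil_iff K).2 fun _ _ _ _ => totπ_totι_of_ne K _ _ _ _ _ _ (by omega) _

lemma isFirstQuadrantFiltration_totFil : IsFirstQuadrantFiltration (tot K) (totFil K) where
  anti h n x hx := (mem_totFil_iff K).2 fun p q hpq hp =>
    (mem_totFil_iff K).1 hx p q hpq (by omega)
  eq_top h n := eq_top_iff.2 fun x _ => (mem_totFil_iff K).2 fun p q _ _ => by omega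
  eq_bot n h := eq_bot_iff.2 fun x hx => tot_ext K fun p q hpq => by
    rw [(mem_totFil_iff K).1 hx p q hpq (by omega), map_zero]
  d_mem {s n x} h := (mem_totFil_iff K).2 fun p q hpq hp => by
    rw [totπ_d K p q n hpq]
    have h₁ : totπ K p (q - 1) n x = 0 ∨ q = 0 := by
      rcases q with _ | q
      · exact Or.inr rfl
      · exact Or.inl ((mem_totFil_iff K).1 h p q (by omega) hp)
    have h₂ : totπ K (p - 1) q n x = 0 ∨ p = 0 := by
      rcases p with _ | p
      · exact Or.inr rfl
      · exact Or.inl ((mem_totFil_iff K).1 h p q (by omega) (by push_cast at hp; omega))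
    have h₁' : (K.X p).d (q - 1) q (totπ K p (q - 1) n x) = 0 := by
      rcases h₁ with h₁ | rfl
      · rw [h₁, map_zero]
      · rw [HomologicalComplex.shape _ _ _ (by simp)]
        rfl
    have h₂' : (K.d (p - 1) p).f q (totπ K (p - 1) q n x) = 0 := by
      rcases h₂ with h₂ | rfl
      · rw [h₂, map_zero]
      · rw [HomologicalComplex.shape _ _ _ (by simp)]
        rfl
    rw [h₁', h₂', smul_zero, add_zero]

end Total

/-! ### Quasi-isomorphism from the augmentation to the total complex -/

section QuasiIso

variable {R : Type u} [CommRing R]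

lemma homologyMap_homologyπ_apply {ι : Type*} {c : ComplexShape ι}
    {K L : HomologicalComplex (ModuleCat.{w} R) c} (f : K ⟶ L) (i : ι) (z : K.cycles i)
    (z' : L.cycles i) (h : f.f i (K.iCycles i z) = L.iCycles i z') :
    HomologicalComplex.homologyMap f i (K.homologyπ i z) = L.homologyπ i z' := by
  rw [← ModuleCat.comp_apply, HomologicalComplex.homologyπ_naturality, ModuleCat.comp_apply]
  refine congrArg _ (injective_iCycles L i ?_)
  rw [← h, ← ModuleCat.comp_apply, HomologicalComplex.cyclesMap_i, ModuleCat.comp_apply]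

lemma hom_comm_apply {ι : Type*} {c : ComplexShape ι}
    {K L : HomologicalComplex (ModuleCat.{w} R) c} (f : K ⟶ L) (i j : ι) (x : K.X i) :
    L.d i j (f.f i x) = f.f j (K.d i j x) := by
  rw [← ModuleCat.comp_apply, f.comm, ModuleCat.comp_apply]

/-- A map of complexes of modules which is injective is a quasi-isomorphism if each element whose
differential lies in the image is congruent to an element of the image modulo boundaries. -/
lemma quasiIso_of_exists_eq_add {ι : Type*} {c : ComplexShape ι}
    {K L : HomologicalComplex (ModuleCat.{w} R) c} (f : K ⟶ L)
    (hf : ∀ i, Function.Injective (f.f i))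
    (h : ∀ (i j : ι) (_ : c.Rel i j) (x : L.X i) (y : K.X j), L.d i j x = f.f j y →
      ∃ (y' : K.X i) (k : ι) (w : L.X k), x = f.f i y' + L.d k i w)
    (h' : ∀ (i : ι) (x : L.X i), (∀ j, L.d i j x = 0) →
      ∃ (y' : K.X i) (k : ι) (w : L.X k), x = f.f i y' + L.d k i w) : QuasiIso f := by
  refine (quasiIso_iff f).2 fun i => (quasiIsoAt_iff_isIso_homologyMap f i).2
    ((ConcreteCategory.isIso_iff_bijective _).2
      ⟨(injective_iff_map_eq_zero _).2 fun a ha => ?_, fun b => ?_⟩)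
  · obtain ⟨z, rfl⟩ := surjective_homologyπ K i a
    obtain ⟨z', hz'⟩ := exists_iCycles_eq L i (f.f i (K.iCycles i z)) fun j => by
      rw [hom_comm_apply, d_iCycles_apply, map_zero]
    rw [homologyMap_homologyπ_apply f i z z' hz'.symm, homologyπ_eq_zero_iff, hz'] at ha
    obtain ⟨j, w, hw⟩ := ha
    refine (homologyπ_eq_zero_iff K i z).2 ?_
    by_cases hji : c.Rel j i
    · obtain ⟨y, k, v, rfl⟩ := h j i hji w _ hw
      rw [map_add, d_d_apply, add_zero, hom_comm_apply] at hw
      exact ⟨j, y, hf i hw⟩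
    · rw [L.shape _ _ hji] at hw
      refine ⟨i, 0, (map_zero _).trans (hf i ?_)⟩
      rw [← hw, map_zero]
      rfl
  · obtain ⟨z, rfl⟩ := surjective_homologyπ L i b
    obtain ⟨y, k, w, hw⟩ := h' i _ fun j => d_iCycles_apply L i j z
    obtain ⟨z', rfl⟩ := exists_iCycles_eq K i y fun j => by
      refine hf j ?_
      rw [← hom_comm_apply, eq_sub_of_add_eq hw.symm, map_sub, d_iCycles_apply, d_d_apply,
        sub_zero, map_zero]
    obtain ⟨z'', hz''⟩ := exists_iCycles_eq L i (f.f i (K.iCycles i z')) fun j => by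
      rw [hom_comm_apply, d_iCycles_apply, map_zero]
    refine ⟨K.homologyπ i z', (homologyMap_homologyπ_apply f i z' z'' hz''.symm).trans ?_⟩
    refine ((homologyπ_eq_iff L i _ _).2 ⟨k, w, ?_⟩).symm
    rw [hw, hz'', add_sub_cancel_left]

variable (K : HomologicalComplex₂ (ModuleCat.{w} R) (ComplexShape.up ℕ) (ComplexShape.up ℕ))

lemma totπ_eq_zero (p q n : ℕ) (h : p + q ≠ n) (x : (tot K).X n) : totπ K p q n x = 0 := by
  have : totπ K p q n = 0 := tot_hom_ext K fun p' q' h' y =>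
    totπ_totι_of_ne K p' q' n p q h' (by omega) y
  rw [this]
  rfl

variable {L : CochainComplex (ModuleCat.{w} R) ℕ} (ψ : L ⟶ K.X 0) (hψ : ψ ≫ K.d 0 1 = 0)

lemma colAugment_apply (n : ℕ) (y : L.X n) :
    (colAugment K L ψ hψ).f n y = totι K 0 n n (zero_add n) (ψ.f n y) := rfl

variable (hψ₀ : ∀ (q : ℕ) (x : (K.X 0).X q), (K.d 0 1).f q x = 0 → ∃ y, ψ.f q y = x)
  (hK : ∀ (p q : ℕ) (x : (K.X (p + 1)).X q), (K.d (p + 1) (p + 2)).f q x = 0 →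
    ∃ w, (K.d p (p + 1)).f q w = x)
include hψ₀ hK

/-- Induction on the highest column `m` meeting `x`. The top component is closed horizontally
because the next column of `d x` vanishes, so exactness lets a boundary remove it; in column `0`
what remains comes from `L`. Only the positive columns of `d x` are required to vanish, so the
statement applies to cocycles and also to elements whose differential comes from `L`, giving
surjectivity and injectivity on homology. -/
lemma exists_eq_colAugment_add (n m : ℕ) (x : (tot K).X n)
    (hm : ∀ p q, m < p → totπ K p q n x = 0)
    (hx : ∀ p q, 0 < p → totπ K p q (n + 1) ((tot K).d n (n + 1) x) = 0) :
    ∃ (y : L.X n) (w : (tot K).X (n - 1)),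
      x = (colAugment K L ψ hψ).f n y + (tot K).d (n - 1) n w := by
  induction m generalizing x with
  | zero =>
    have h := hx 1 n one_pos
    rw [totπ_d K 1 n n (add_comm 1 n), hm 1 _ one_pos, map_zero, smul_zero, add_zero] at h
    obtain ⟨y, hy⟩ := hψ₀ n _ h
    refine ⟨y, 0, ?_⟩
    rw [map_zero, add_zero, colAugment_apply, hy]
    refine tot_ext K fun p q hpq => ?_
    rcases p with _ | p
    · obtain rfl : q = n := by omega
      exact (totπ_totι_self K 0 q q _ _).symm
    · rw [hm _ _ (Nat.succ_pos p), totπ_totι_of_ne K _ _ _ _ _ _ (by omega)]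
  | succ m ih =>
    by_cases hmn : m + 1 ≤ n
    · obtain ⟨q, rfl⟩ : ∃ q, n = m + q + 1 := ⟨n - (m + 1), by omega⟩
      have h := hx (m + 2) q (by omega)
      rw [totπ_d K (m + 2) q (m + q + 1) (by omega), hm (m + 2) _ (by omega), map_zero, smul_zero,
        add_zero] at h
      obtain ⟨w, hw⟩ := hK m q _ h
      -- Subtracting the total differential of `w` cancels column `m + 1` and otherwise changes only
      -- column `m`.
      obtain ⟨y, v, hv⟩ := ih (x - (tot K).d (m + q) (m + q + 1) (totι K m q (m + q) rfl w))
        (fun p q' hp => by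
          rw [tot_d_totι, map_sub, map_add, map_zsmul,
            totπ_totι_of_ne K m (q + 1) _ p q' _ (by omega), smul_zero, add_zero, hw]
          by_cases hp' : p = m + 1
          · subst hp'
            by_cases hq' : q = q'
            · subst hq'
              rw [totπ_totι_self]
              exact sub_self _
            · rw [totπ_totι_of_ne K _ _ _ _ _ _ (by omega), totπ_eq_zero K _ _ _ (by omega),
                sub_zero]
          · rw [totπ_totι_of_ne K _ _ _ _ _ _ (by omega), hm _ _ (by omega), sub_zero])
        (fun p q' hp => by rw [map_sub, d_d_apply, sub_zero, hx p q' hp])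
      change (tot K).X (m + q) at v
      refine ⟨y, (v + totι K m q (m + q) rfl w : (tot K).X (m + q)), ?_⟩
      change x = _ + (tot K).d (m + q) (m + q + 1) _
      change _ = _ + (tot K).d (m + q) (m + q + 1) v at hv
      rw [map_add, ← add_assoc, ← hv]
      exact (sub_add_cancel _ _).symm
    · refine ih x (fun p q hp => ?_) hx
      by_cases hp' : m + 1 < p
      · exact hm p q hp'
      · exact totπ_eq_zero K _ _ _ (by omega) x

/-- If the rows of a first quadrant bicomplex are resolutions, then the augmentation is a
quasi-isomorphism to the total complex. -/
lemma quasiIso_colAugment (hinj : ∀ q, Function.Injective (ψ.f q)) :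
    QuasiIso (colAugment K L ψ hψ) := by
  have key (n : ℕ) (x : (tot K).X n)
      (hx : ∀ p q, 0 < p → totπ K p q (n + 1) ((tot K).d n (n + 1) x) = 0) :
      ∃ (y' : L.X n) (k : ℕ) (w : (tot K).X k),
        x = (colAugment K L ψ hψ).f n y' + (tot K).d k n w := by
    obtain ⟨y, w, h⟩ := exists_eq_colAugment_add K ψ hψ hψ₀ hK n n x
      (fun p q hp => totπ_eq_zero K p q n (by omega) x) hx
    exact ⟨y, _, w, h⟩
  refine quasiIso_of_exists_eq_add _ (fun n y y' h => hinj n ?_) ?_ fun n x hx => key n x ?_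
  · have h' := congrArg (totπ K 0 n n) h
    rwa [colAugment_apply, colAugment_apply, totπ_totι_self, totπ_totι_self] at h'
  · rintro n _ rfl x y hxy
    refine key n x fun p q hp => ?_
    rw [hxy, colAugment_apply, totπ_totι_of_ne K _ _ _ _ _ _ (by omega)]
  · intro p q _
    rw [hx, map_zero]

end QuasiIso

/-! ### Ext classes represented by cocycles of an injective resolution -/

section ExtMk

variable {A : Type u} [Category.{v} A] [Abelian A] [HasExt.{w} A] {X Y : A}
  (E : InjectiveResolution Y)

/-- Includes degree `0`, where `n - 1` is read as `0` and `d 0 0 = 0`, so that the right-hand side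
says `f = 0`. -/
lemma extMk_eq_zero_iff_exists {n : ℕ} (f : X ⟶ E.cocomplex.X n) (m : ℕ) (hm : n + 1 = m)
    (hf : f ≫ E.cocomplex.d n m = 0) :
    E.extMk f m hm hf = 0 ↔
      ∃ g : X ⟶ E.cocomplex.X (n - 1), g ≫ E.cocomplex.d (n - 1) n = f := by
  rcases n with _ | n
  · have h0 : E.cocomplex.d (0 - 1) 0 = 0 := E.cocomplex.shape _ _ (by simp)
    constructor
    · intro h
      rw [← E.extEquivCohomologyClass.apply_eq_iff_eq,
        InjectiveResolution.extEquivCohomologyClass_extMk,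
        InjectiveResolution.extEquivCohomologyClass_zero,
        CochainComplex.HomComplex.CohomologyClass.mk_eq_zero_iff,
        CochainComplex.HomComplex.Cocycle.fromSingleMk_mem_coboundaries_iff _ _ _ _ _ (-1)
          (by simp)] at h
      obtain ⟨g, hg⟩ := h
      -- The resolution, extended to integer degrees, is zero in degree `-1`.
      have hg0 : g = 0 := (E.cochainComplex.isZero_of_isStrictlyGE 0 (-1)).eq_of_tgt _ _
      rw [hg0, Limits.zero_comp] at hg
      refine ⟨0, ?_⟩
      rw [Limits.zero_comp]
      exact ((cancel_mono (E.cochainComplexXIso (0 : ℕ) 0 rfl).inv).1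
        (hg.symm.trans Limits.zero_comp.symm)).symm
    · rintro ⟨g, rfl⟩
      simp only [h0, Limits.comp_zero]
      exact E.extMk_zero m hm
  · exact E.extMk_eq_zero_iff f m hm hf n rfl

/-- Scalars act on `Ext` through precomposition with `r • 𝟙 X`. -/
lemma smul_extMk {R : Type u'} [CommRing R] [Linear R A] {n : ℕ} (r : R)
    (f : X ⟶ E.cocomplex.X n) (m : ℕ) (hm : n + 1 = m) (hf : f ≫ E.cocomplex.d n m = 0) :
    r • E.extMk f m hm hf = E.extMk (r • f) m hm (by rw [Linear.smul_comp, hf, smul_zero]) := by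
  have h := E.mk₀_comp_extMk f m hm hf (r • 𝟙 X)
  rw [Abelian.Ext.mk₀_smul, Abelian.Ext.smul_comp, Abelian.Ext.mk₀_id_comp] at h
  rw [h]
  congr 1
  rw [Linear.smul_comp, Category.id_comp]

end ExtMk

/-! ### Maps from homology to injective modules -/

section HomologyDesc

variable {R : Type u} [CommRing R] (F : ChainComplex (ModuleCat.{w} R) ℕ)

/-- The map on homology induced by a map on chains vanishing on boundaries. -/
noncomputable def homologyDesc {q : ℕ} {I : ModuleCat.{w} R} (f : F.X q ⟶ I)
    (hf : F.d (q + 1) q ≫ f = 0) : F.homology q ⟶ I :=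
  F.homologyι q ≫ F.descOpcycles f (q + 1) (ChainComplex.prev ℕ q) hf

lemma homologyπ_homologyDesc {q : ℕ} {I : ModuleCat.{w} R} (f : F.X q ⟶ I)
    (hf : F.d (q + 1) q ≫ f = 0) :
    F.homologyπ q ≫ homologyDesc F f hf = F.iCycles q ≫ f := by
  rw [homologyDesc, HomologicalComplex.homology_π_ι_assoc, HomologicalComplex.p_descOpcycles]

lemma homologyDesc_eq_iff {q : ℕ} {I : ModuleCat.{w} R} (f : F.X q ⟶ I)
    (hf : F.d (q + 1) q ≫ f = 0) (g : F.homology q ⟶ I) :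
    homologyDesc F f hf = g ↔ F.iCycles q ≫ f = F.homologyπ q ≫ g := by
  rw [← cancel_epi (F.homologyπ q), homologyπ_homologyDesc]

/-- Homology embeds into the quotient of `F_q` by boundaries, and `g` extends along this embedding
because `I` is injective. -/
lemma exists_homologyDesc_eq {q : ℕ} {I : ModuleCat.{w} R} [Injective I] (g : F.homology q ⟶ I) :
    ∃ (f : F.X q ⟶ I) (hf : F.d (q + 1) q ≫ f = 0), homologyDesc F f hf = g := by
  refine ⟨F.pOpcycles q ≫ Injective.factorThru g (F.homologyι q), ?_, ?_⟩
  · rw [HomologicalComplex.d_pOpcycles_assoc, Limits.zero_comp]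
  · rw [homologyDesc_eq_iff, ← HomologicalComplex.homology_π_ι_assoc, Injective.comp_factorThru]

/-- The hypothesis says that `f` vanishes on cycles. It therefore factors through the image of `F_q
→ F_{q-1}`, and injectivity of `I` extends it to `F_{q-1}`. -/
lemma exists_d_comp_eq {q : ℕ} {I : ModuleCat.{w} R} [Injective I] (f : F.X q ⟶ I)
    (hf : F.d (q + 1) q ≫ f = 0) (h : homologyDesc F f hf = 0) :
    ∃ g : F.X (q - 1) ⟶ I, F.d q (q - 1) ≫ g = f := by
  have hq : (ComplexShape.down ℕ).next q = q - 1 := by cases q <;> simp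
  have hex := ShortComplex.exact_of_f_is_kernel
    (ShortComplex.mk _ _ (F.iCycles_d q (q - 1))) (F.cyclesIsKernel q _ hq)
  have hf' : F.iCycles q ≫ f = 0 := by
    rw [← homologyπ_homologyDesc F f hf, h, Limits.comp_zero]
  exact ⟨hex.descToInjective f hf', hex.comp_descToInjective f hf'⟩

end HomologyDesc

/-! ### The Hom bicomplex and the components of `Z_r` and of boundaries -/

section HomBicomplex

variable {R : Type u} [CommRing R] (F : ChainComplex (ModuleCat.{w} R) ℕ)

/-- The augmentation to the total Hom complex is a quasi-isomorphism if the modules `F_n` are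
projective. -/
lemma quasiIso_homResolve [∀ n, Projective (F.X n)] {N : ModuleCat.{w} R}
    (E : InjectiveResolution N) : QuasiIso (homResolve F E) := by
  unfold homResolve homAugment
  refine quasiIso_colAugment (homBicomplex F E.cocomplex) _ _ ?_ ?_ ?_
  · intro q (φ : F.X q ⟶ E.cocomplex.X 0) (hφ : φ ≫ E.cocomplex.d 0 1 = 0)
    obtain ⟨l, hl⟩ := Limits.KernelFork.IsLimit.lift' E.isLimitKernelFork φ hφ
    exact ⟨l, hl⟩
  · intro p q (φ : F.X q ⟶ E.cocomplex.X (p + 1))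
      (hφ : φ ≫ E.cocomplex.d (p + 1) (p + 2) = 0)
    -- Projectivity of `F_q` is what makes `Hom(F_q, -)` preserve exactness of the resolution.
    exact ⟨(E.exact_succ p).liftFromProjective φ hφ, (E.exact_succ p).liftFromProjective_comp φ hφ⟩
  · intro q (φ : F.X q ⟶ N) (φ' : F.X q ⟶ N) (h : φ ≫ E.ι.f 0 = φ' ≫ E.ι.f 0)
    have hE : Mono (E.ι.f 0) := inferInstance
    exact hE.right_cancellation φ φ' h

/-- An element of bidegree `(p, q)` of the bicomplex, as a map `F_q → E^p`. -/
noncomputable abbrev homπ (E : CochainComplex (ModuleCat.{w} R) ℕ) (p q n : ℕ)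
    (x : (tot (homBicomplex F E)).X n) : F.X q ⟶ E.X p :=
  totπ (homBicomplex F E) p q n x

variable {F} {E : CochainComplex (ModuleCat.{w} R) ℕ}

lemma homπ_d (p q n : ℕ) (h : p + q = n + 1) (x : (tot (homBicomplex F E)).X n) :
    homπ F E p q (n + 1) ((tot (homBicomplex F E)).d n (n + 1) x) =
      homπ F E (p - 1) q n x ≫ E.d (p - 1) p +
        (-1 : ℤ) ^ p • F.d q (q - 1) ≫ homπ F E p (q - 1) n x :=
  totπ_d (homBicomplex F E) p q n h x

lemma homπ_eq_zero_of_mem {s : ℤ} {n : ℕ} {x : (tot (homBicomplex F E)).X n}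
    (hx : x ∈ totFil (homBicomplex F E) s n) (p q : ℕ) (hp : (p : ℤ) < s) :
    homπ F E p q n x = 0 := by
  by_cases h : p + q = n
  · exact (mem_totFil_iff _).1 hx p q h hp
  · exact totπ_eq_zero _ _ _ _ h x

lemma homπ_sub (p q n : ℕ) (x y : (tot (homBicomplex F E)).X n) :
    homπ F E p q n (x - y) = homπ F E p q n x - homπ F E p q n y :=
  map_sub (totπ (homBicomplex F E) p q n).hom x y

/-- The `(p, q)`-component of an element of `Z_r^{p,q}`, `r ≥ 1`, vanishes on boundaries. -/
lemma d_comp_homπ_eq_zero {p q n : ℕ} (hn : p + q = n) {r : ℤ} (hr : 1 ≤ r)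
    {x : (tot (homBicomplex F E)).X n}
    (hx : x ∈ filZ _ (totFil (homBicomplex F E)) r p n) :
    F.d (q + 1) q ≫ homπ F E p q n x = 0 := by
  have h := homπ_eq_zero_of_mem (mem_filZ.1 hx).2 p (q + 1) (by omega)
  rw [homπ_d p (q + 1) n (by omega)] at h
  have h' : homπ F E (p - 1) (q + 1) n x = 0 := by
    rcases p with _ | p
    · exact totπ_eq_zero _ _ _ _ (by omega) x
    · exact homπ_eq_zero_of_mem (mem_filZ.1 hx).1 _ _ (by simp)
  rw [h', Limits.zero_comp, zero_add] at h
  have h'' := congrArg ((-1 : ℤ) ^ p • ·) h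
  simpa [smul_smul, ← mul_pow] using h''

/-- The `(p, q)`-component of an element of `Z_r^{p,q}`, `r ≥ 2`, gives a cocycle with values in
`E^p`. -/
lemma homologyDesc_homπ_comp_d {p q n : ℕ} (hn : p + q = n) {r : ℤ} (hr : 2 ≤ r)
    {x : (tot (homBicomplex F E)).X n}
    (hx : x ∈ filZ _ (totFil (homBicomplex F E)) r p n) :
    homologyDesc F (homπ F E p q n x) (d_comp_homπ_eq_zero hn (by omega) hx) ≫
      E.d p (p + 1) = 0 := by
  have h := homπ_eq_zero_of_mem (mem_filZ.1 hx).2 (p + 1) q (by push_cast; omega)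
  rw [homπ_d (p + 1) q n (by omega)] at h
  change homπ F E p q n x ≫ E.d p (p + 1) + _ = 0 at h
  -- Since `d x` lies in `Fil^{p+2}`, the horizontal differential of the component is minus a map
  -- factoring through `F.d q (q - 1)`, and such a map is zero on cycles.
  rw [← cancel_epi (F.homologyπ q), ← Category.assoc, homologyπ_homologyDesc, Category.assoc,
    eq_neg_of_add_eq_zero_left h]
  simp

/-- The components `F_q → E^p` of boundaries of elements of `Z_1^{p-1}`. -/
lemma exists_homπ_d_eq_of_vertical (p q n : ℕ) (hn : p + q = n) (g : F.X (q - 1) ⟶ E.X p) :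
    ∃ b ∈ filZ _ (totFil (homBicomplex F E)) 1 (p - 1) (n - 1),
      homπ F E p q n ((tot (homBicomplex F E)).d (n - 1) n b) = F.d q (q - 1) ≫ g := by
  rcases q with _ | q
  · refine ⟨0, zero_mem _, ?_⟩
    rw [F.shape 0 (0 - 1) (by simp), Limits.zero_comp, map_zero]
    exact map_zero (totπ (homBicomplex F E) p 0 n).hom
  · subst hn
    let b : (tot (homBicomplex F E)).X (p + q) :=
      (-1 : ℤ) ^ p • totι (homBicomplex F E) p q (p + q) rfl g
    have hb : b ∈ totFil (homBicomplex F E) p (p + q) :=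
      zsmul_mem (totι_mem_totFil _ _ _ _ _ le_rfl _) _
    have hF := isFirstQuadrantFiltration_totFil (homBicomplex F E)
    refine ⟨b, mem_filZ.2 ⟨hF.anti (by omega) _ hb, ?_⟩, ?_⟩
    · rw [sub_add_cancel]
      exact hF.d_mem hb
    · refine (homπ_d p (q + 1) (p + q) rfl b).trans ?_
      have h₁ : homπ F E (p - 1) (q + 1) (p + q) b = 0 := by
        rcases p with _ | p
        · exact totπ_eq_zero _ _ _ _ (by omega) b
        · exact homπ_eq_zero_of_mem hb _ _ (by simp)
      have h₂ : homπ F E p q (p + q) b = (-1 : ℤ) ^ p • g :=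
        (map_zsmul (totπ (homBicomplex F E) p q (p + q)).hom _ _).trans
          (congrArg ((-1 : ℤ) ^ p • ·) (totπ_totι_self _ _ _ _ _ _))
      rw [h₁, Limits.zero_comp, zero_add]
      change (-1 : ℤ) ^ p • F.d (q + 1) q ≫ homπ F E p q (p + q) b = F.d (q + 1) q ≫ g
      rw [h₂]
      simp [smul_smul, ← mul_pow]

/-- Placed in bidegree `(p - 1, q)`, the map `f` has zero vertical differential by `hf`, so its
total differential is the single term `f ≫ d`. -/
lemma exists_homπ_d_eq_of_horizontal (p q n : ℕ) (hn : p + q = n) (f : F.X q ⟶ E.X (p - 1))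
    (hf : F.d (q + 1) q ≫ f = 0) :
    ∃ b ∈ filZ _ (totFil (homBicomplex F E)) 1 (p - 1) (n - 1),
      homπ F E p q n ((tot (homBicomplex F E)).d (n - 1) n b) = f ≫ E.d (p - 1) p := by
  rcases p with _ | p
  · refine ⟨0, zero_mem _, ?_⟩
    rw [E.shape (0 - 1) 0 (by simp), Limits.comp_zero, map_zero]
    exact map_zero (totπ (homBicomplex F E) 0 q n).hom
  · obtain rfl : n = p + q + 1 := by omega
    have hd : (tot (homBicomplex F E)).d (p + q) (p + q + 1)
        (totι (homBicomplex F E) p q (p + q) rfl f) =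
        totι (homBicomplex F E) (p + 1) q (p + q + 1) (by omega) (f ≫ E.d p (p + 1)) := by
      refine (tot_d_totι (homBicomplex F E) p q (p + q) rfl f).trans ?_
      have h0 : ((homBicomplex F E).X p).d q (q + 1) f = 0 := hf
      rw [h0, map_zero, smul_zero, add_zero]
      rfl
    refine ⟨totι (homBicomplex F E) p q (p + q) rfl f, mem_filZ.2
      ⟨totι_mem_totFil _ _ _ _ _ (by push_cast; omega) _, ?_⟩, ?_⟩
    · refine (congrArg (· ∈ totFil (homBicomplex F E) _ _) hd).mpr
        (totι_mem_totFil _ _ _ _ _ (by push_cast; omega) _)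
    · exact (congrArg (totπ (homBicomplex F E) (p + 1) q (p + q + 1)) hd).trans
        (totπ_totι_self _ _ _ _ _ _)

/-- Converse to the two preceding constructions: `f` and, up to sign, `g` are the components of `b`
in columns `p - 1` and `p`. Membership in `Z_1` makes `f` vanish on boundaries. -/
lemma exists_homπ_d_eq (p q n : ℕ) (hn : p + q = n) {b : (tot (homBicomplex F E)).X (n - 1)}
    (hb : b ∈ filZ _ (totFil (homBicomplex F E)) 1 (p - 1) (n - 1)) :
    ∃ (f : F.X q ⟶ E.X (p - 1)) (_ : F.d (q + 1) q ≫ f = 0) (g : F.X (q - 1) ⟶ E.X p),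
      homπ F E p q n ((tot (homBicomplex F E)).d (n - 1) n b) =
        f ≫ E.d (p - 1) p + F.d q (q - 1) ≫ g := by
  rcases n with _ | n
  · refine ⟨0, Limits.comp_zero, 0, ?_⟩
    rw [(tot (homBicomplex F E)).shape (0 - 1) 0 (by simp), Limits.comp_zero, Limits.zero_comp,
      add_zero]
    exact map_zero (totπ (homBicomplex F E) p q 0).hom
  · refine ⟨homπ F E (p - 1) q n b, ?_, (-1 : ℤ) ^ p • homπ F E p (q - 1) n b, ?_⟩
    · rcases p with _ | p
      · refine (congrArg (F.d (q + 1) q ≫ ·) (totπ_eq_zero _ _ _ _ (by omega) b)).trans ?_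
        exact Limits.comp_zero
      · exact d_comp_homπ_eq_zero (by omega) le_rfl (by simpa using hb)
    · rw [Preadditive.comp_zsmul]
      exact homπ_d p q n hn b

end HomBicomplex

/-! ### Identification of the second page with Ext -/

section SecondPage

variable {R : Type u} [CommRing R] [Small.{w} R] (F : ChainComplex (ModuleCat.{w} R) ℕ)
  {N : ModuleCat.{w} R} (E : InjectiveResolution N)

lemma extMk_congr {X : ModuleCat.{w} R} {n : ℕ} {f g : X ⟶ E.cocomplex.X n} (h : f = g)
    (hf : f ≫ E.cocomplex.d n (n + 1) = 0) (hg : g ≫ E.cocomplex.d n (n + 1) = 0) :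
    E.extMk f (n + 1) rfl hf = E.extMk g (n + 1) rfl hg := by
  subst h
  rfl

/-- The map `Z_2^{p,q} → Ext^p(H_q(F), N)`. -/
noncomputable def secondPageMap (p q : ℕ) :
    filZ _ (totFil (homBicomplex F E.cocomplex)) 2 p (p + q) →ₗ[R]
      Abelian.Ext (F.homology q) N p where
  toFun x := E.extMk (homologyDesc F (homπ F E.cocomplex p q (p + q) x)
    (d_comp_homπ_eq_zero rfl (by norm_num) x.2)) (p + 1) rfl
    (homologyDesc_homπ_comp_d rfl le_rfl x.2)
  map_add' x y := by
    rw [E.add_extMk]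
    refine extMk_congr E ?_ _ _
    rw [homologyDesc_eq_iff, Preadditive.comp_add, homologyπ_homologyDesc, homologyπ_homologyDesc,
      ← Preadditive.comp_add]
    exact congrArg _ (map_add (totπ (homBicomplex F E.cocomplex) p q (p + q)).hom x.1 y.1)
  map_smul' r x := by
    rw [RingHom.id_apply, smul_extMk]
    refine extMk_congr E ?_ _ _
    rw [homologyDesc_eq_iff, Linear.comp_smul, homologyπ_homologyDesc, ← Linear.comp_smul]
    exact congrArg _ (map_smul (totπ (homBicomplex F E.cocomplex) p q (p + q)).hom r x.1)

lemma secondPageMap_eq {p q : ℕ}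
    (x : filZ _ (totFil (homBicomplex F E.cocomplex)) 2 p (p + q)) {f : F.X q ⟶ E.cocomplex.X p}
    (h : homπ F E.cocomplex p q (p + q) x = f) (hf : F.d (q + 1) q ≫ f = 0)
    (hf' : homologyDesc F f hf ≫ E.cocomplex.d p (p + 1) = 0) :
    secondPageMap F E p q x = E.extMk (homologyDesc F f hf) (p + 1) rfl hf' := by
  subst h
  rfl

lemma secondPageMap_eq_zero_iff {p q : ℕ}
    (x : filZ _ (totFil (homBicomplex F E.cocomplex)) 2 p (p + q)) :
    secondPageMap F E p q x = 0 ↔ ∃ g : F.homology q ⟶ E.cocomplex.X (p - 1),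
      F.iCycles q ≫ homπ F E.cocomplex p q (p + q) x =
        F.homologyπ q ≫ g ≫ E.cocomplex.d (p - 1) p := by
  rw [secondPageMap_eq F E x rfl (d_comp_homπ_eq_zero rfl (by norm_num) x.2)
    (homologyDesc_homπ_comp_d rfl le_rfl x.2), extMk_eq_zero_iff_exists]
  exact exists_congr fun g => eq_comm.trans (homologyDesc_eq_iff _ _ _ _)

/-- A cocycle `φ : H_q(F) → E^p` comes from some `f : F_q → E^p`. Its differential `f ≫ d` vanishes
on cycles but perhaps not on `F_q`, so it equals `F.d ≫ g` with `g : F_{q-1} → E^{p+1}`. Correcting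
`f` by `± g` in the next column pushes the total differential into `Fil^{p+2}` without changing the
`(p, q)`-component. -/
lemma surjective_secondPageMap (p q : ℕ) : Function.Surjective (secondPageMap F E p q) := by
  intro α
  obtain ⟨φ, hφ, rfl⟩ := E.extMk_surjective α (p + 1) rfl
  obtain ⟨f, hf, rfl⟩ := exists_homologyDesc_eq F φ
  have hf' : F.d (q + 1) q ≫ f ≫ E.cocomplex.d p (p + 1) = 0 := by
    rw [reassoc_of% hf, Limits.zero_comp]
  obtain ⟨g, hg⟩ := exists_d_comp_eq F (f ≫ E.cocomplex.d p (p + 1)) hf' (by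
    rw [homologyDesc_eq_iff, ← Category.assoc, ← homologyπ_homologyDesc F f hf, Category.assoc,
      hφ])
  let K := homBicomplex F E.cocomplex
  suffices ∃ y ∈ totFil K (p + 1) (p + q),
      totι K p q (p + q) rfl f - y ∈ filZ _ (totFil K) 2 p (p + q) by
    obtain ⟨y, hy, hfy⟩ := this
    refine ⟨⟨_, hfy⟩, secondPageMap_eq F E _ ?_ hf hφ⟩
    refine (homπ_sub p q (p + q) _ y).trans ?_
    rw [homπ_eq_zero_of_mem hy p q (by omega), sub_zero]
    exact totπ_totι_self K p q (p + q) rfl f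
  have hd : (tot K).d (p + q) (p + q + 1) (totι K p q (p + q) rfl f) =
      totι K (p + 1) q (p + q + 1) (by omega) (F.d q (q - 1) ≫ g) := by
    refine (tot_d_totι K p q (p + q) rfl f).trans ?_
    have h0 : (K.X p).d q (q + 1) f = 0 := hf
    rw [h0, map_zero, smul_zero, add_zero, hg]
    rfl
  have hF := isFirstQuadrantFiltration_totFil K
  have hmem : totι K p q (p + q) rfl f ∈ totFil K p (p + q) := totι_mem_totFil _ _ _ _ _ le_rfl _
  -- For `q = 0` there is no `F_{q-1}` and no correction is needed: `F.d 0 0 = 0` already gives a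
  -- total differential equal to zero.
  rcases q with _ | q
  · refine ⟨0, zero_mem _, ?_⟩
    rw [sub_zero]
    refine mem_filZ.2 ⟨hmem, ?_⟩
    rw [hd, F.shape 0 (0 - 1) (by simp), Limits.zero_comp]
    refine (congrArg (· ∈ _) (map_zero (totι K (p + 1) 0 (p + 0 + 1) (by omega)).hom)).mpr ?_
    exact zero_mem _
  · change F.X q ⟶ E.cocomplex.X (p + 1) at g
    -- The sign cancels the one carried by the vertical differential in column `p + 1`.
    let y : (tot K).X (p + q + 1) :=
      (-1 : ℤ) ^ (p + 1) • totι K (p + 1) q (p + q + 1) (by omega) g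
    have hy : y ∈ totFil K (p + 1) (p + q + 1) :=
      zsmul_mem (totι_mem_totFil _ _ _ _ _ (by push_cast; rfl) _) _
    refine ⟨y, hy, mem_filZ.2 ⟨sub_mem hmem (hF.anti (by omega) _ hy), ?_⟩⟩
    have hdy : (tot K).d (p + q + 1) (p + q + 1 + 1) y =
        (-1 : ℤ) ^ (p + 1) • totι K (p + 2) q (p + q + 1 + 1) (by omega)
          (g ≫ E.cocomplex.d (p + 1) (p + 2)) +
        totι K (p + 1) (q + 1) (p + q + 1 + 1) (by omega) (F.d (q + 1) q ≫ g) := by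
      refine (map_zsmul ((tot K).d (p + q + 1) (p + q + 1 + 1)).hom _ _).trans ?_
      refine (congrArg ((-1 : ℤ) ^ (p + 1) • ·)
        (tot_d_totι K (p + 1) q (p + q + 1) (by omega) g)).trans ?_
      refine (smul_add _ _ _).trans (congrArg₂ (· + ·) rfl ?_)
      rw [smul_smul, ← mul_pow, neg_one_mul, neg_neg, one_pow, one_smul]
      rfl
    have h : (tot K).d (p + q + 1) (p + q + 1 + 1) (totι K p (q + 1) (p + (q + 1)) rfl f - y) =
        -((-1 : ℤ) ^ (p + 1) • totι K (p + 2) q (p + q + 1 + 1) (by omega)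
          (g ≫ E.cocomplex.d (p + 1) (p + 2))) := by
      rw [map_sub, hdy]
      refine (congrArg (· - _) hd).trans ?_
      exact sub_add_cancel_right _ _
    refine (congrArg (· ∈ totFil K (p + 2) (p + q + 1 + 1)) h).mpr (neg_mem (zsmul_mem ?_ _))
    exact totι_mem_totFil _ _ _ _ _ (by push_cast; rfl) _

/-- The kernel of the map to `Ext` is the module `B_2`. -/
lemma ker_secondPageMap (p q : ℕ) : LinearMap.ker (secondPageMap F E p q) =
    (filB _ (totFil (homBicomplex F E.cocomplex)) 2 p (p + q)).comap
      (filZ _ (totFil (homBicomplex F E.cocomplex)) 2 p (p + q)).subtype := by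
  ext ⟨x, hx⟩
  rw [LinearMap.mem_ker, secondPageMap_eq_zero_iff]
  refine Iff.trans ?_ mem_filB.symm
  change _ ↔ ∃ a ∈ _, ∃ b ∈ _, a + _ = x
  rw [show (p : ℤ) - 2 + 1 = p - 1 by ring]
  constructor
  · rintro ⟨g', hg'⟩
    obtain ⟨f', hf', rfl⟩ := exists_homologyDesc_eq F g'
    have h₁ : F.d (q + 1) q ≫ (homπ F E.cocomplex p q (p + q) x -
        f' ≫ E.cocomplex.d (p - 1) p) = 0 := by
      rw [Preadditive.comp_sub, d_comp_homπ_eq_zero rfl (by norm_num) hx, reassoc_of% hf',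
        Limits.zero_comp, sub_zero]
    obtain ⟨g, hg⟩ := exists_d_comp_eq F _ h₁ (by
      rw [homologyDesc_eq_iff, Preadditive.comp_sub, ← Category.assoc (F.iCycles q) f',
        ← homologyπ_homologyDesc F f' hf', Category.assoc, hg', sub_self, Limits.comp_zero])
    -- The component of `x` is now `f' ≫ d + F.d ≫ g`. Both terms are components of boundaries of
    -- `Z_1^{p-1}`, and subtracting these leaves an element of `Fil^{p+1}`.
    obtain ⟨b₁, hb₁, h₂⟩ := exists_homπ_d_eq_of_horizontal p q (p + q) rfl f' hf'
    obtain ⟨b₂, hb₂, h₃⟩ := exists_homπ_d_eq_of_vertical p q (p + q) rfl g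
    have hb : b₁ + b₂ ∈ filZ _ (totFil (homBicomplex F E.cocomplex)) 1 (p - 1) (p + q - 1) :=
      add_mem hb₁ hb₂
    refine ⟨x - (tot _).d _ _ (b₁ + b₂), ?_, b₁ + b₂, hb, sub_add_cancel _ _⟩
    refine mem_filZ.2 ⟨(mem_totFil_iff _).2 fun p' q' hpq hp' => ?_, ?_⟩
    · by_cases h : p' = p
      · obtain rfl : q' = q := by omega
        subst h
        rw [map_add]
        refine (homπ_sub _ _ _ _ _).trans ?_
        refine (congrArg (homπ F E.cocomplex p' q' (p' + q') x - ·)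
          ((map_add (totπ (homBicomplex F E.cocomplex) p' q' (p' + q')).hom _ _).trans
            (congrArg₂ (· + ·) h₂ h₃))).trans ?_
        rw [hg]
        exact sub_eq_zero.2 (add_sub_cancel _ _).symm
      -- In columns below `p` both terms vanish, as `d` sends `Z_1^{p-1}` into `Fil^p`.
      · refine (mem_totFil_iff _).1 (sub_mem (mem_filZ.1 hx).1 ?_) p' q' hpq
          (show (p' : ℤ) < p by omega)
        exact (mem_filZ.1 (d_mem_filZ _ _ (by ring) hb)).1
    · rw [map_sub, d_d_apply, sub_zero]
      have := (mem_filZ.1 hx).2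
      rwa [show (p : ℤ) + 1 + (2 - 1) = p + 2 by ring]
  · rintro ⟨a, ha, b, hb, rfl⟩
    obtain ⟨f, hf, g, hfg⟩ := exists_homπ_d_eq p q (p + q) rfl hb
    refine ⟨homologyDesc F f hf, ?_⟩
    have h : homπ F E.cocomplex p q (p + q) (a + (tot _).d (p + q - 1) (p + q) b) =
        f ≫ E.cocomplex.d (p - 1) p + F.d q (q - 1) ≫ g := by
      refine (map_add (totπ (homBicomplex F E.cocomplex) p q (p + q)).hom _ _).trans ?_
      refine (congrArg₂ (· + ·) (homπ_eq_zero_of_mem (mem_filZ.1 ha).1 p q (by omega)) hfg).trans ?_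
      exact zero_add _
    change F.iCycles q ≫ homπ F E.cocomplex p q (p + q) (a + _) = _
    rw [h, ← Category.assoc (F.homologyπ q), homologyπ_homologyDesc]
    simp

/-- The second page of the spectral sequence of the bicomplex `Hom_R(F_q, E^p)`. -/
noncomputable def secondPageEquiv (p q : ℕ) :
    (filPage (tot (homBicomplex F E.cocomplex)) (totFil (homBicomplex F E.cocomplex)) 2).X (p, q)
      ≃ₗ[R] Abelian.Ext (F.homology q) N p :=
  quotEquivOfSurjective (secondPageMap F E p q) (surjective_secondPageMap F E p q) _
    (ker_secondPageMap F E p q)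

end SecondPage

end CatHom

/-- Universal coefficients spectral sequence for the Mac Lane cohomology of commutative rings. -/
theorem mainTheorem4 (R : Type u) [CommRing R] (M : Type v) [AddCommGroup M] [Module R M] :
    -- `α` and `β` are isomorphisms
    (∀ P Q : CatHom.FGProj R, Function.Bijective (CatHom.traceDual R M P Q) ∧
      Function.Bijective (CatHom.tensorHom R M P Q)) ∧
    -- they determine a cochain isomorphism `Φ`
    ∃ Φ : CatHom.homComplex (CatHom.pwProj.{v} R) (CatHom.liftMod R M) ≅ CatHom.bwProj R M,
      (∀ (n : ℕ) (φ : (CatHom.pwProj.{v} R).X n ⟶ CatHom.liftMod R M)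
        (X : CatHom.Str (CatHom.FGProj R) (SimplexCategory.mk n))
        (t : M ⊗[R] (X.last.obj →ₗ[R] X.first.obj)),
        (∀ g : X.first.obj →ₗ[R] X.last.obj, CatHom.traceDual R M X.last X.first t g =
          (φ (CatHom.pwChain (CatHom.homBimod.{v} R) n X (ULift.up g))).down) →
        CatHom.bwCoord (CatHom.homTensorBimod R M) n X (Φ.hom.f n φ) =
          CatHom.tensorHom R M X.last X.first t) ∧
      -- for every injective resolution `E` of `M`, the spectral sequence of the bicomplex
      -- `Hom_R(F_*(P(R), Hom_R), E^*)` has the required second page and limit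
      ∀ E : InjectiveResolution (CatHom.liftMod R M),
        QuasiIso (CatHom.homResolve (CatHom.pwProj.{v} R) E) ∧
        ∃ (S : E₂CohomologicalSpectralSequenceNat (ModuleCat.{max v (u + 1)} R))
          (ρ : CatHom.IsSpectralSequenceOf S
            (CatHom.tot (CatHom.homBicomplex (CatHom.pwProj.{v} R) E.cocomplex))
            (CatHom.totFil (CatHom.homBicomplex (CatHom.pwProj.{v} R) E.cocomplex)))
          (c : CatHom.ConvergesTo S (CatHom.HMLCohomology R M)),
          (∀ p q : ℕ, Nonempty ((S.page 2).X (p, q) ≃ₗ[R]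
            Abelian.Ext (CatHom.HMLHomology.{v} R q) (CatHom.liftMod R M) p)) ∧
          CatHom.IsInducedConvergence ρ c (fun n =>
            HomologicalComplex.homologyMap Φ.inv n ≫
              HomologicalComplex.homologyMap (CatHom.homResolve (CatHom.pwProj.{v} R) E) n) := by
  refine ⟨fun P Q => ⟨CatHom.bijective_traceDual R M P Q, CatHom.bijective_tensorHom R M P Q⟩,
    CatHom.traceIso R M, CatHom.bwCoord_traceIso R M, fun E => ?_⟩
  have hproj (n : ℕ) : Projective ((CatHom.pwProj.{v} R).X n) := by
    have := CatHom.projective_pwProj.{v} R n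
    exact (IsProjective.iff_projective ((CatHom.pwProj.{v} R).X n)).1 this
  have hE : QuasiIso (CatHom.homResolve (CatHom.pwProj.{v} R) E) := CatHom.quasiIso_homResolve _ E
  have hF := CatHom.isFirstQuadrantFiltration_totFil
    (CatHom.homBicomplex (CatHom.pwProj.{v} R) E.cocomplex)
  have hθ (n : ℕ) : Function.Bijective
      (HomologicalComplex.homologyMap (CatHom.traceIso R M).inv n ≫
        HomologicalComplex.homologyMap (CatHom.homResolve (CatHom.pwProj.{v} R) E) n) :=
    (ConcreteCategory.isIso_iff_bijective _).1 inferInstance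
  exact ⟨hE, hF.spectralSequence, hF.isSpectralSequenceOf,
    hF.convergesTo hF.isSpectralSequenceOf _ hθ,
    fun p q => ⟨CatHom.secondPageEquiv (CatHom.pwProj.{v} R) E p q⟩,
    hF.isInducedConvergence _ _ hθ⟩
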